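/- Let $\mathcal{K}$ be a non-archimedean local field with ring of integers $\mathcal{O}_{\mathcal{K}}$ and maximal ideal $m_{\mathcal{K}}$, and let $\mathcal{L}/\mathcal{K}$ be a finite Galois extension of local fields with cyclic Galois group $G=\mathrm{Gal}(\mathcal{L}/\mathcal{K})$. Assume that $\mathcal{L}/\mathcal{K}$ is at most weakly ramified, that is, the second ramification group in lower numbering $G_2=\{\sigma\in G : \sigma(x)\equiv x \bmod m_{\mathcal{L}}^{3}\text{ for all }x\in\mathcal{O}_{\mathcal{L}}\}$ is trivial. Let $\mathfrak{F}$ be a (one-dimensional, commutative) formal group law over $\mathcal{O}_{\mathcal{K}}$ of height at least $2$ (possibly infinite), where the height of $\mathfrak{F}$ is the height of its reduction $\overline{\mathfrak{F}}$ over the residue field of characteristic $p$: the largest $h$ such that $[p]_{\overline{\mathfrak{F}}}(X)$ is a power series in $X^{p^h}$, and $\infty$ if $[p]_{\overline{\mathfrak{F}}}=0$. Let $\mathfrak{F}(m_{\mathcal{L}})$ denote the set $m_{\mathcal{L}}$ with the group law $x+_{\mathfrak{F}}y=\mathfrak{F}(x,y)$ and the natural action of $G$, and similarly $\mathfrak{F}(m_{\mathcal{K}})$.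 Then the $\mathfrak{F}$-norm $$\mathrm{Tr}^{\mathfrak{F}}\colon \mathfrak{F}(m_{\mathcal{L}})\to\mathfrak{F}(m_{\mathcal{K}}),\qquad x\mapsto \sum_{\sigma\in G}{}^{\mathfrak{F}}\,\sigma(x)$$ (the sum being taken with respect to $+_{\mathfrak{F}}$) is surjective, and $$H^i\bigl(G,\mathfrak{F}(m_{\mathcal{L}})\bigr)=0\quad\text{for all } i>0 .$$ -/

import Mathlib

open IsLocalRing ValuativeRel

universe u v

set_option linter.unusedSectionVars false

namespace FormalGroup

section Evaluation

variable {σ τ R S S' : Type*} [CommRing R]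
  [CommRing S] [IsLocalRing S] [Algebra R S]
  [CommRing S'] [IsLocalRing S'] [Algebra R S']

/-- The value `f(a)` of a power series `f` over `R` at a family `a` of elements of a local
`R`-algebra `S`: the sum of its monomials, evaluated at `a`, in the topology of `S` defined by the
powers of the maximal ideal. -/
noncomputable def adicEval (f : MvPowerSeries σ R) (a : σ → S) : S :=
  letI : WithIdeal S := ⟨maximalIdeal S⟩
  ∑' d : σ →₀ ℕ, algebraMap R S (MvPowerSeries.coeff d f) * d.prod fun s e => a s ^ e

section Facts

variable [IsAdicComplete (maximalIdeal S) S] [IsAdicComplete (maximalIdeal S') S']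

theorem adic_complete :
    letI : WithIdeal S := ⟨maximalIdeal S⟩
    CompleteSpace S ∧ T2Space S := by
  let : WithIdeal S := ⟨maximalIdeal S⟩
  have h : IsAdic (WithIdeal.i : Ideal S) := rfl
  exact h.isAdicComplete_iff.mp ‹IsAdicComplete (maximalIdeal S) S›

theorem adic_hasEval [Finite σ] {a : σ → S} (ha : ∀ s, a s ∈ maximalIdeal S) :
    letI : WithIdeal S := ⟨maximalIdeal S⟩
    MvPowerSeries.HasEval a := by
  let : WithIdeal S := ⟨maximalIdeal S⟩
  exact ⟨fun s => WithIdeal.isTopologicallyNilpotent_of_mem (ha s), by simp⟩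

theorem adicEval_eq_eval₂ [Finite σ] (f : MvPowerSeries σ R) {a : σ → S}
    (ha : ∀ s, a s ∈ maximalIdeal S) :
    letI : WithIdeal S := ⟨maximalIdeal S⟩
    letI : UniformSpace R := ⊥
    adicEval f a = MvPowerSeries.eval₂ (algebraMap R S) a f := by
  let : WithIdeal S := ⟨maximalIdeal S⟩
  let : UniformSpace R := ⊥
  have : DiscreteUniformity R := ⟨rfl⟩
  have := (adic_complete (S := S)).1
  have := (adic_complete (S := S)).2
  exact (MvPowerSeries.eval₂_eq_tsum (continuous_of_discreteTopology) (adic_hasEval ha) f).symm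

/-- The sum that defines `adicEval` converges. -/
theorem hasSum_adicEval [Finite σ] (f : MvPowerSeries σ R) {a : σ → S}
    (ha : ∀ s, a s ∈ maximalIdeal S) :
    letI : WithIdeal S := ⟨maximalIdeal S⟩
    HasSum (fun d : σ →₀ ℕ =>
      algebraMap R S (MvPowerSeries.coeff d f) * d.prod fun s e => a s ^ e) (adicEval f a) := by
  let : WithIdeal S := ⟨maximalIdeal S⟩
  let : UniformSpace R := ⊥
  have : DiscreteUniformity R := ⟨rfl⟩
  have := (adic_complete (S := S)).1
  have := (adic_complete (S := S)).2
  rw [adicEval_eq_eval₂ f ha]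
  exact MvPowerSeries.hasSum_eval₂ (continuous_of_discreteTopology) (adic_hasEval ha) f

theorem adicEval_X [Finite σ] (s : σ) {a : σ → S} (ha : ∀ s, a s ∈ maximalIdeal S) :
    adicEval (MvPowerSeries.X s : MvPowerSeries σ R) a = a s := by
  let : WithIdeal S := ⟨maximalIdeal S⟩
  let : UniformSpace R := ⊥
  rw [adicEval_eq_eval₂ _ ha, MvPowerSeries.eval₂_X]

theorem adicEval_zero (a : σ → S) : adicEval (0 : MvPowerSeries σ R) a = 0 := by
  simp [adicEval]

theorem map_adicEval [Finite σ] (φ : S →ₐ[R] S')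
    (hφ : ∀ x ∈ maximalIdeal S, φ x ∈ maximalIdeal S') (f : MvPowerSeries σ R) {a : σ → S}
    (ha : ∀ s, a s ∈ maximalIdeal S) :
    φ (adicEval f a) = adicEval f fun s => φ (a s) := by
  let : WithIdeal S := ⟨maximalIdeal S⟩
  let : WithIdeal S' := ⟨maximalIdeal S'⟩
  have := (adic_complete (S := S')).2
  have hc : Continuous φ.toRingHom :=
    (WithIdeal.uniformContinuous_of_map_le (f := φ.toRingHom) (Ideal.map_le_iff_le_comap.mpr hφ)).continuous
  have h := (hasSum_adicEval f ha).map φ.toRingHom.toAddMonoidHom hc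
  have h' := hasSum_adicEval f (a := fun s => φ (a s)) fun s => hφ _ (ha s)
  refine h.unique ?_
  convert h' using 2 with d
  simp [Finsupp.prod]

theorem hasSum_mem_pow {ι : Type*} {g : ι → S} {y : S} (n : ℕ)
    (hy : letI : WithIdeal S := ⟨maximalIdeal S⟩; HasSum g y)
    (hg : ∀ d, g d ∈ maximalIdeal S ^ n) : y ∈ maximalIdeal S ^ n := by
  let : WithIdeal S := ⟨maximalIdeal S⟩
  have hcl : IsClosed ((maximalIdeal S ^ n : Ideal S) : Set S) :=
    (Ideal.openAddSubgroup (maximalIdeal S) n).isClosed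
  exact hcl.mem_of_tendsto hy (Filter.Eventually.of_forall fun s => Ideal.sum_mem _ fun d _ => hg d)

theorem adicEval_mem [Finite σ] (f : MvPowerSeries σ R)
    (hf : MvPowerSeries.constantCoeff f = 0) {a : σ → S}
    (ha : ∀ s, a s ∈ maximalIdeal S) : adicEval f a ∈ maximalIdeal S := by
  classical
  rw [← pow_one (maximalIdeal S)]
  refine hasSum_mem_pow 1 (hasSum_adicEval f ha) fun d => ?_
  rw [pow_one]
  by_cases hd : d = 0
  · subst hd
    simp [hf]
  · obtain ⟨s, hs⟩ := Finsupp.ne_iff.mp hd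
    refine Ideal.mul_mem_left _ _ ?_
    rw [Finsupp.prod, ← Finset.mul_prod_erase _ _ (Finsupp.mem_support_iff.mpr hs)]
    exact Ideal.mul_mem_right _ _ (Ideal.pow_mem_of_mem _ (ha s) _ (Nat.pos_of_ne_zero hs))

theorem adicEval_subst [Finite σ] [Finite τ] (f : MvPowerSeries σ R)
    {g : σ → MvPowerSeries τ R} (hg : ∀ s, MvPowerSeries.constantCoeff (g s) = 0) {a : τ → S}
    (ha : ∀ s, a s ∈ maximalIdeal S) :
    adicEval (MvPowerSeries.subst g f) a = adicEval f fun s => adicEval (g s) a := by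
  let : WithIdeal S := ⟨maximalIdeal S⟩
  let : UniformSpace R := ⊥
  have : DiscreteUniformity R := ⟨rfl⟩
  have := (adic_complete (S := S)).1
  have := (adic_complete (S := S)).2
  have hc : Continuous (algebraMap R S) := continuous_of_discreteTopology
  have hs : MvPowerSeries.HasSubst g := MvPowerSeries.hasSubst_of_constantCoeff_zero hg
  open scoped MvPowerSeries.WithPiTopology in
  have h := MvPowerSeries.comp_eval₂ (σ := σ) (φ := algebraMap R (MvPowerSeries τ R)) (a := g)
    continuous_of_discreteTopology
    ((MvPowerSeries.hasSubst_iff_hasEval_of_discreteTopology).mp hs)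
    (ε := MvPowerSeries.eval₂Hom hc (adic_hasEval ha))
    (by rw [MvPowerSeries.coe_eval₂Hom]; exact MvPowerSeries.continuous_eval₂ hc (adic_hasEval ha))
  have h' := congrFun h f
  have hφ : (MvPowerSeries.eval₂Hom hc (adic_hasEval ha)).comp
      (algebraMap R (MvPowerSeries τ R)) = algebraMap R S := by
    ext r
    rw [RingHom.comp_apply, MvPowerSeries.coe_eval₂Hom, ← MvPowerSeries.c_eq_algebraMap,
      MvPowerSeries.eval₂_C]
  rw [hφ, Function.comp_apply, MvPowerSeries.coe_eval₂Hom, ← MvPowerSeries.subst_eq_eval₂] at h'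
  rw [adicEval_eq_eval₂ _ ha, h', adicEval_eq_eval₂]
  · congr 1
    funext s
    rw [adicEval_eq_eval₂ _ ha]
    rfl
  · intro s
    exact adicEval_mem _ (hg s) ha

end Facts

end Evaluation

section Points

variable {R S S' : Type*} [CommRing R]
  [CommRing S] [IsLocalRing S] [Algebra R S]
  [CommRing S'] [IsLocalRing S'] [Algebra R S']

/-- The points `F(m_S)` of a formal group `F` over `R` in the maximal ideal `m_S` of a local
`R`-algebra `S`. -/
@[ext]
structure LocalPoint (F : FormalGroup R) (S : Type*) [CommRing S] [IsLocalRing S] [Algebra R S] where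
  /-- the underlying element of the maximal ideal -/
  val : S
  mem : val ∈ maximalIdeal S

theorem pair_mem {x y : S} (hx : x ∈ maximalIdeal S) (hy : y ∈ maximalIdeal S) :
    ∀ s : Fin 2, (![x, y] : Fin 2 → S) s ∈ maximalIdeal S := by
  intro s
  fin_cases s <;> simpa

namespace LocalPoint

variable (F : FormalGroup R) [IsAdicComplete (maximalIdeal S) S]
  [IsAdicComplete (maximalIdeal S') S']

/-- The group law of `F(m_S)`: `x + y = F(x, y)`. -/
noncomputable instance : Add (F.LocalPoint S) where
  add x y := ⟨adicEval F.toPowerSeries ![x.val, y.val],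
    adicEval_mem _ F.zero_constantCoeff (pair_mem x.mem y.mem)⟩

instance : Zero (F.LocalPoint S) where
  zero := ⟨0, zero_mem _⟩

variable {F}

theorem val_add (x y : F.LocalPoint S) :
    (x + y).val = adicEval F.toPowerSeries ![x.val, y.val] := rfl

theorem val_zero : (0 : F.LocalPoint S).val = 0 := rfl

theorem add_zero' (x : F.LocalPoint S) : x + 0 = x := by
  have h := F.add_zero (f := (MvPowerSeries.X 0 : MvPowerSeries (Fin 1) R))
    (PowerSeries.HasSubst.X 0)
  have ha : ∀ s : Fin 1, (![x.val] : Fin 1 → S) s ∈ maximalIdeal S := by simpa using x.mem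
  have h' := congrArg (fun f => adicEval f ![x.val]) h
  rw [adicEval_subst _ (fun s => by fin_cases s <;> simp) ha, adicEval_X _ ha] at h'
  ext
  rw [val_add, val_zero]
  refine Eq.trans ?_ h'
  congr 1
  funext s
  fin_cases s
  · exact (adicEval_X (R := R) 0 ha).symm
  · exact (adicEval_zero (R := R) _).symm

theorem add_assoc' (x y z : F.LocalPoint S) : x + y + z = x + (y + z) := by
  have ha : ∀ s : Fin 3, (![x.val, y.val, z.val] : Fin 3 → S) s ∈ maximalIdeal S := by
    intro s
    fin_cases s
    · exact x.mem
    · exact y.mem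
    · exact z.mem
  have hX : ∀ i j : Fin 3, ∀ s : Fin 2, MvPowerSeries.constantCoeff
      ((![MvPowerSeries.X i, MvPowerSeries.X j] : Fin 2 → MvPowerSeries (Fin 3) R) s) = 0 := by
    intro i j s
    fin_cases s <;> simp
  have hF : ∀ i j : Fin 3, MvPowerSeries.constantCoeff (MvPowerSeries.subst
      (![MvPowerSeries.X i, MvPowerSeries.X j] : Fin 2 → MvPowerSeries (Fin 3) R)
        F.toPowerSeries) = 0 := fun i j =>
    MvPowerSeries.constantCoeff_subst_eq_zero MvPowerSeries.HasSubst.X_X (hX i j)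
      F.zero_constantCoeff
  have he : ∀ i j : Fin 3, adicEval (MvPowerSeries.subst
      (![MvPowerSeries.X i, MvPowerSeries.X j] : Fin 2 → MvPowerSeries (Fin 3) R)
        F.toPowerSeries) ![x.val, y.val, z.val] =
      adicEval F.toPowerSeries ![(![x.val, y.val, z.val] : Fin 3 → S) i,
        (![x.val, y.val, z.val] : Fin 3 → S) j] := by
    intro i j
    rw [adicEval_subst _ (hX i j) ha]
    congr 1
    funext s
    fin_cases s <;> exact adicEval_X _ ha
  have h' := congrArg (fun f => adicEval f ![x.val, y.val, z.val]) F.assoc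
  rw [adicEval_subst _ _ ha, adicEval_subst _ _ ha] at h'
  · ext
    rw [val_add, val_add, val_add, val_add]
    convert h' using 2
    · funext s
      fin_cases s
      · exact (he 0 1).symm
      · exact (adicEval_X (R := R) 2 ha).symm
    · funext s
      fin_cases s
      · exact (adicEval_X (R := R) 0 ha).symm
      · exact (he 1 2).symm
  · intro s
    fin_cases s
    · simp
    · exact hF 1 2
  · intro s
    fin_cases s
    · exact hF 0 1
    · simp

theorem add_comm' [F.IsComm] (x y : F.LocalPoint S) : x + y = y + x := by
  have h' := congrArg (fun f => adicEval f ![x.val, y.val]) (IsComm.comm (F := F))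
  have ha := pair_mem x.mem y.mem
  rw [adicEval_subst _ (fun s => by fin_cases s <;> simp) ha] at h'
  ext
  rw [val_add, val_add, h']
  congr 1
  funext s
  fin_cases s <;> exact adicEval_X _ ha

/-- `F(x, y) - F(x, y')` and `y - y'` agree to higher order. -/
theorem adicEval_sub (F : FormalGroup R) {n : ℕ} {x y y' : S} (hx : x ∈ maximalIdeal S)
    (hy : y ∈ maximalIdeal S) (hy' : y' ∈ maximalIdeal S) (h : y - y' ∈ maximalIdeal S ^ n) :
    adicEval F.toPowerSeries ![x, y] - adicEval F.toPowerSeries ![x, y'] - (y - y') ∈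
      maximalIdeal S ^ (n + 1) := by
  classical
  let : WithIdeal S := ⟨maximalIdeal S⟩
  have hpow : ∀ j : ℕ, y ^ j - y' ^ j ∈ maximalIdeal S ^ n := fun j =>
    Ideal.mem_of_dvd _ (sub_dvd_pow_sub_pow y y' j) h
  have h1 := ((hasSum_adicEval F.toPowerSeries (pair_mem hx hy)).sub
    (hasSum_adicEval F.toPowerSeries (pair_mem hx hy'))).sub
    (hasSum_ite_eq (Finsupp.single (1 : Fin 2) 1) (y - y'))
  refine hasSum_mem_pow (n + 1) h1 fun d => ?_
  simp only [Finsupp.prod_fintype, pow_zero, implies_true, Fin.prod_univ_two,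
    Matrix.cons_val_zero, Matrix.cons_val_one]
  split_ifs with hd
  · subst hd
    rw [F.lin_coeff_Y]
    simp
  · have hmem : x ^ d 0 * (y ^ d 1 - y' ^ d 1) ∈ maximalIdeal S ^ (n + 1) := by
      rw [pow_succ']
      by_cases h0 : d 0 = 0
      · rcases hj : d 1 with _ | _ | j
        · simp
        · exfalso
          apply hd
          ext s
          fin_cases s
          · simpa using h0
          · simpa using hj
        · refine Ideal.mul_mem_left _ _ ?_
          have : y ^ (j + 1 + 1) - y' ^ (j + 1 + 1) =
              y * (y ^ (j + 1) - y' ^ (j + 1)) + y' ^ (j + 1) * (y - y') := by ring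
          rw [this]
          exact Ideal.add_mem _ (Ideal.mul_mem_mul hy (hpow _))
            (Ideal.mul_mem_mul (Ideal.pow_mem_of_mem _ hy' _ (Nat.succ_pos _)) h)
      · exact Ideal.mul_mem_mul (Ideal.pow_mem_of_mem _ hx _ (Nat.pos_of_ne_zero h0)) (hpow _)
    have := Ideal.mul_mem_left _ (algebraMap R S (MvPowerSeries.coeff d F.toPowerSeries)) hmem
    convert this using 1
    ring

theorem exists_add_eq_zero (x : F.LocalPoint S) : ∃ y : F.LocalPoint S, x + y = 0 := by
  let u : ℕ → F.LocalPoint S := fun n => n.rec 0 fun _ y =>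
    ⟨y.val - (x + y).val, sub_mem y.mem (x + y).mem⟩
  have hu : ∀ n, (u (n + 1)).val = (u n).val - (x + u n).val := fun n => rfl
  have hstep : ∀ n, (u (n + 1)).val - (u n).val ∈ maximalIdeal S ^ n := by
    intro n
    induction n with
    | zero => simp
    | succ n ih =>
      have := adicEval_sub F x.mem (u (n + 1)).mem (u n).mem ih
      rw [← val_add, ← val_add] at this
      rw [hu (n + 1), hu n, ← neg_mem_iff]
      rw [hu n] at this
      convert this using 1
      ring
  obtain ⟨L, hL⟩ := IsPrecomplete.prec' (I := maximalIdeal S) (fun n => (u n).val) (by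
    intro m n hmn
    induction n, hmn using Nat.le_induction with
    | base => rfl
    | succ n hmn ih =>
      refine ih.trans ?_
      rw [SModEq.comm, SModEq.sub_mem, smul_eq_mul, Ideal.mul_top]
      exact Ideal.pow_le_pow_right hmn (hstep n))
  have hL' : ∀ n, L - (u n).val ∈ maximalIdeal S ^ n := by
    intro n
    have := (hL n).symm
    rwa [SModEq.sub_mem, smul_eq_mul, Ideal.mul_top] at this
  have hLm : L ∈ maximalIdeal S := by
    have := add_mem (hL' 1) ((pow_one (maximalIdeal S)).symm ▸ (u 1).mem)
    simpa using this
  refine ⟨⟨L, hLm⟩, ?_⟩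
  ext
  rw [val_zero]
  refine IsHausdorff.haus' (I := maximalIdeal S) _ fun n => ?_
  rw [SModEq.zero, smul_eq_mul, Ideal.mul_top]
  have h1 := Ideal.pow_le_pow_right (Nat.le_succ n) (adicEval_sub F x.mem hLm (u n).mem (hL' n))
  have h2 : (x + u n).val ∈ maximalIdeal S ^ n := by
    rw [← neg_mem_iff]
    have := hstep n
    rw [hu n] at this
    convert this using 1
    ring
  have h3 := add_mem (add_mem h1 (hL' n)) h2
  convert h3 using 1
  rw [val_add, val_add]
  ring

noncomputable instance : Neg (F.LocalPoint S) where
  neg x := (exists_add_eq_zero x).choose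

theorem add_neg' (x : F.LocalPoint S) : x + -x = 0 := (exists_add_eq_zero x).choose_spec

/-- `F(m_S)` is an abelian group under `x + y = F(x, y)`. -/
noncomputable instance [F.IsComm] : AddCommGroup (F.LocalPoint S) where
  add_assoc := add_assoc'
  zero_add x := by rw [add_comm', add_zero']
  add_zero := add_zero'
  nsmul := nsmulRec
  zsmul := zsmulRec
  neg_add_cancel x := by rw [add_comm', add_neg']
  add_comm := add_comm'

variable [F.IsComm]

variable (F) in
/-- The homomorphism `F(m_S) → F(m_S')` induced by a local homomorphism `S → S'`. -/
noncomputable def map (φ : S →ₐ[R] S') (hφ : ∀ x ∈ maximalIdeal S, φ x ∈ maximalIdeal S') :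
    F.LocalPoint S →+ F.LocalPoint S' where
  toFun x := ⟨φ x.val, hφ _ x.mem⟩
  map_zero' := by
    ext
    simp [val_zero]
  map_add' x y := by
    ext
    refine (map_adicEval φ hφ _ (pair_mem x.mem y.mem)).trans ?_
    rw [val_add]
    congr 1
    funext s
    fin_cases s <;> rfl

theorem val_map (φ : S →ₐ[R] S') (hφ : ∀ x ∈ maximalIdeal S, φ x ∈ maximalIdeal S')
    (x : F.LocalPoint S) : (map F φ hφ x).val = φ x.val := rfl

section Action

variable {G : Type*} [Group G] [MulSemiringAction G S] [SMulCommClass G R S]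

theorem smul_mem_maximalIdeal (g : G) {x : S} (hx : x ∈ maximalIdeal S) :
    g • x ∈ maximalIdeal S := by
  rw [mem_maximalIdeal, mem_nonunits_iff] at hx ⊢
  exact fun h => hx (by simpa using h.map (MulSemiringAction.toRingHom G S g⁻¹))

/-- A group of `R`-algebra automorphisms of `S` acts on `F(m_S)`. -/
noncomputable instance : DistribMulAction G (F.LocalPoint S) where
  smul g x := ⟨g • x.val, smul_mem_maximalIdeal g x.mem⟩
  one_smul x := LocalPoint.ext (one_smul G x.val)
  mul_smul g h x := LocalPoint.ext (mul_smul g h x.val)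
  smul_zero g := LocalPoint.ext (smul_zero g)
  smul_add g x y :=
    (map F (MulSemiringAction.toAlgHom R S g) fun _ hx => smul_mem_maximalIdeal g hx).map_add x y

theorem val_smul (g : G) (x : F.LocalPoint S) : (g • x).val = g • x.val := rfl

end Action

end LocalPoint

end Points

section Height

/-- The multiplication-by-`n` series `[n]_F(X)` of a formal group `F`, that is
`[0]_F = 0` and `[n + 1]_F = F([n]_F(X), X)`. -/
noncomputable def mulSeries {R : Type*} [CommRing R] (F : FormalGroup R) : ℕ → PowerSeries R
  | 0 => 0
  | n + 1 => F.toPowerSeries.subst ![F.mulSeries n, PowerSeries.X]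

/-- The height of a formal group over a ring of prime characteristic `p`: the largest `h` such that
`[p]_F(X) = g(X ^ (p ^ h))` for some power series `g`, and `∞` if there is no largest one
(that is, if `[p]_F = 0`). -/
noncomputable def height {k : Type*} [CommRing k] (F : FormalGroup k) (p : ℕ) : ℕ∞ :=
  ⨆ h ∈ {h : ℕ | ∃ g : PowerSeries k, F.mulSeries p = g.subst (PowerSeries.X ^ p ^ h : PowerSeries k)}, (h : ℕ∞)

end Height

end FormalGroup

namespace IsNonarchimedeanLocalField

section Complete

variable (K : Type*) [Field K] [ValuativeRel K] [TopologicalSpace K]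
  [IsNonarchimedeanLocalField K]

/-- The ring of integers of a local field is complete for the topology defined by the powers of its
maximal ideal. -/
instance isAdicComplete_integer : IsAdicComplete 𝓂[K] 𝒪[K] := by
  let := IsTopologicalAddGroup.rightUniformSpace K
  have := isUniformAddGroup_of_addCommGroup (G := K)
  infer_instance

variable {K}

theorem mem_maximalIdeal_iff (x : 𝒪[K]) : x ∈ 𝓂[K] ↔ valuation K (x : K) < 1 := by
  rw [mem_maximalIdeal, mem_nonunits_iff,
    (Valuation.integer.integers (valuation K)).isUnit_iff_valuation_eq_one]
  exact ⟨fun h => lt_of_le_of_ne x.2 h, fun h => h.ne⟩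

theorem valuation_lt_one_iff (x : K) :
    valuation K x < 1 ↔ Filter.Tendsto (fun n : ℕ => x ^ n) Filter.atTop (nhds 0) := by
  rw [(IsValuativeTopology.hasBasis_nhds_zero K).tendsto_right_iff]
  constructor
  · intro h γ _
    obtain ⟨n, hn⟩ := exists_pow_lt₀ h γ
    filter_upwards [Filter.eventually_ge_atTop n] with m hm
    rw [map_pow]
    exact (pow_le_pow_right_of_le_one' h.le hm).trans_lt hn
  · intro h
    obtain ⟨n, hn⟩ := (h 1 trivial).exists
    by_contra! hx
    rw [Set.mem_ofPred_eq, map_pow, Units.val_one] at hn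
    exact absurd hn (not_lt.mpr (one_le_pow_of_one_le' hx n))

end Complete

section Extension

variable {K : Type v} {L : Type u}
  [Field K] [ValuativeRel K] [TopologicalSpace K] [IsNonarchimedeanLocalField K]
  [Field L] [ValuativeRel L] [TopologicalSpace L] [IsNonarchimedeanLocalField L]
  [Algebra K L] [ValuativeExtension K L]

instance hasExtension : (valuation K).HasExtension (valuation L) where
  val_isEquiv_comap := fun a b => by
    rw [Valuation.comap_apply, Valuation.comap_apply, ← Valuation.Compatible.vle_iff_le,
      ← Valuation.Compatible.vle_iff_le, ValuativeExtension.vle_iff_vle]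

theorem continuous_algebraMap_extension : Continuous (algebraMap K L) := by
  refine continuous_of_continuousAt_zero (algebraMap K L) ?_
  rw [ContinuousAt, map_zero, (IsValuativeTopology.hasBasis_nhds_zero K).tendsto_iff
    (IsValuativeTopology.hasBasis_nhds_zero L)]
  intro γ _
  obtain ⟨π, hπ0, hπ1⟩ := Valuation.IsNontrivial.exists_lt_one (v := valuation K)
  have hπL : valuation L (algebraMap K L π) < 1 :=
    (Valuation.HasExtension.val_map_lt_one_iff (valuation K) (valuation L) π).mpr hπ1
  obtain ⟨n, hn⟩ := exists_pow_lt₀ hπL γ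
  refine ⟨Units.mk0 (valuation K (π ^ n)) (by simp_all), trivial,
    fun x hx => ?_⟩
  rw [Set.mem_ofPred_eq, Units.val_mk0] at hx
  have := (Valuation.HasExtension.val_map_lt_iff (valuation K) (valuation L) x (π ^ n)).mpr hx
  rw [map_pow, map_pow] at this
  exact this.trans hn

variable [FiniteDimensional K L]

theorem continuous_galois (σ : Gal(L/K)) : Continuous σ := by
  let := IsTopologicalAddGroup.rightUniformSpace K
  have := isUniformAddGroup_of_addCommGroup (G := K)
  let : (Valued.v (R := K) (Γ₀ := ValueGroupWithZero K)).RankOne :=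
  { hom' := IsRankLeOne.nonempty.some.emb (R := K).comp MonoidWithZeroHom.ValueGroup₀.embedding
    strictMono' := IsRankLeOne.nonempty.some.strictMono.comp
        MonoidWithZeroHom.ValueGroup₀.embedding_strictMono }
  have : ContinuousSMul K L := ⟨by
    simp only [Algebra.smul_def]
    exact (continuous_algebraMap_extension.comp continuous_fst).mul continuous_snd⟩
  have : T2Space L := by
    let := IsTopologicalAddGroup.rightUniformSpace L
    have := isUniformAddGroup_of_addCommGroup (G := L)
    infer_instance
  let : NontriviallyNormedField K := Valued.toNontriviallyNormedField (L := K) (Γ₀ := ValueGroupWithZero K)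
  exact LinearMap.continuous_of_finiteDimensional (𝕜 := K) σ.toLinearMap

theorem valuation_galois_lt_one (σ : Gal(L/K)) {x : L} (hx : valuation L x < 1) :
    valuation L (σ x) < 1 := by
  rw [valuation_lt_one_iff] at hx ⊢
  have := (continuous_galois σ).tendsto 0 |>.comp hx
  simpa [Function.comp_def] using this

theorem valuation_galois_le_one (σ : Gal(L/K)) {x : L} (hx : valuation L x ≤ 1) :
    valuation L (σ x) ≤ 1 := by
  by_contra! h
  have h1 : valuation L (σ x)⁻¹ < 1 := by
    rw [map_inv₀]
    exact inv_lt_one_of_one_lt₀ h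
  have h2 := valuation_galois_lt_one σ.symm h1
  rw [map_inv₀, AlgEquiv.symm_apply_apply, map_inv₀] at h2
  have hx0 : valuation L x ≠ 0 := by
    rw [Valuation.ne_zero_iff]
    rintro rfl
    simp at h
  exact absurd h2 (not_lt.mpr ((one_le_inv₀ (zero_lt_iff.mpr hx0)).mpr hx))

/-- The action of the Galois group on the ring of integers. -/
noncomputable instance galoisActionInteger : MulSemiringAction Gal(L/K) 𝒪[L] where
  smul σ x := ⟨σ (x : L), valuation_galois_le_one σ x.2⟩
  one_smul _ := rfl
  mul_smul _ _ _ := rfl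
  smul_zero σ := Subtype.ext (map_zero σ)
  smul_add σ _ _ := Subtype.ext (map_add σ _ _)
  smul_one σ := Subtype.ext (map_one σ)
  smul_mul σ _ _ := Subtype.ext (map_mul σ _ _)

theorem coe_galois_smul (σ : Gal(L/K)) (x : 𝒪[L]) : ((σ • x : 𝒪[L]) : L) = σ (x : L) := rfl

instance galoisActionInteger_comm : SMulCommClass Gal(L/K) 𝒪[K] 𝒪[L] where
  smul_comm σ a x := Subtype.ext <| by
    rw [coe_galois_smul, Valuation.HasExtension.val_smul, Valuation.HasExtension.val_smul,
      coe_galois_smul]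
    exact map_smul σ (a : K) (x : L)

variable (K L) in
/-- The `i`-th ramification group of `L/K` in lower numbering: the `σ` in the Galois group that act
trivially on `𝒪_L / m_L ^ (i + 1)`. -/
noncomputable def ramificationGroup (i : ℕ) : Subgroup Gal(L/K) :=
  (𝓂[L] ^ (i + 1)).toAddSubgroup.inertia Gal(L/K)

variable (K L) in
/-- `L/K` is at most weakly ramified: its second ramification group is trivial. -/
def IsAtMostWeaklyRamified : Prop := ramificationGroup K L 2 = ⊥

end Extension

end IsNonarchimedeanLocalField

namespace FormalGroup

open IsNonarchimedeanLocalField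

variable {K : Type v} [Field K] [ValuativeRel K] [TopologicalSpace K] [IsNonarchimedeanLocalField K]

/-- The height of a formal group over the ring of integers of a local field, that is, the height of
its reduction over the residue field. -/
noncomputable def localHeight (F : FormalGroup 𝒪[K]) : ℕ∞ :=
  (F.map (residue 𝒪[K])).height (ringChar 𝓀[K])

variable (F : FormalGroup 𝒪[K]) [F.IsComm]
  (L : Type u) [Field L] [ValuativeRel L] [TopologicalSpace L] [IsNonarchimedeanLocalField L]
  [Algebra K L] [ValuativeExtension K L]

/-- The inclusion `F(m_K) → F(m_L)`. -/
noncomputable def inclusion : F.LocalPoint 𝒪[K] →+ F.LocalPoint 𝒪[L] :=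
  LocalPoint.map F (Algebra.ofId 𝒪[K] 𝒪[L]) fun x hx => by
    rw [mem_maximalIdeal_iff] at hx ⊢
    exact (Valuation.HasExtension.val_map_lt_one_iff (valuation K) (valuation L) (x : K)).mpr hx

theorem inclusion_injective : Function.Injective (F.inclusion L) := fun x y h =>
  LocalPoint.ext <| Subtype.ext <| (algebraMap K L).injective <|
    congrArg (fun z : F.LocalPoint 𝒪[L] => (z.val : L)) h

variable [FiniteDimensional K L] [IsGalois K L]

theorem exists_inclusion_eq_norm (x : F.LocalPoint 𝒪[L]) :
    ∃ y : F.LocalPoint 𝒪[K], F.inclusion L y = ∑ σ : Gal(L/K), σ • x := by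
  set z := ∑ σ : Gal(L/K), σ • x with hz
  have hfix : ∀ τ : Gal(L/K), τ • z = z := by
    intro τ
    rw [hz, Finset.smul_sum]
    simp only [smul_smul]
    exact Fintype.sum_equiv (Equiv.mulLeft τ) _ _ fun σ => rfl
  obtain ⟨a, ha⟩ := (IsGalois.mem_range_algebraMap_iff_fixed (F := K) (z.val : L)).mpr fun τ =>
    congrArg (fun w : F.LocalPoint 𝒪[L] => (w.val : L)) (hfix τ)
  have hlt : valuation K a < 1 := by
    rw [← Valuation.HasExtension.val_map_lt_one_iff (valuation K) (valuation L), ha]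
    exact (mem_maximalIdeal_iff z.val).mp z.mem
  exact ⟨⟨⟨a, hlt.le⟩, (mem_maximalIdeal_iff _).mpr hlt⟩, LocalPoint.ext (Subtype.ext ha)⟩

/-- The `F`-norm `F(m_L) → F(m_K)`: it sends `x` to the sum of its conjugates in `F(m_L)`, which
lies in `F(m_K)`. -/
noncomputable def norm : F.LocalPoint 𝒪[L] →+ F.LocalPoint 𝒪[K] where
  toFun x := (F.exists_inclusion_eq_norm L x).choose
  map_zero' := F.inclusion_injective L <| by
    rw [(F.exists_inclusion_eq_norm L 0).choose_spec]
    simp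
  map_add' x y := F.inclusion_injective L <| by
    rw [map_add, (F.exists_inclusion_eq_norm L (x + y)).choose_spec,
      (F.exists_inclusion_eq_norm L x).choose_spec, (F.exists_inclusion_eq_norm L y).choose_spec]
    simp [Finset.sum_add_distrib]

theorem inclusion_norm (x : F.LocalPoint 𝒪[L]) :
    F.inclusion L (F.norm L x) = ∑ σ : Gal(L/K), σ • x :=
  (F.exists_inclusion_eq_norm L x).choose_spec

instance smulCommClass_ulift_int :
    SMulCommClass Gal(L/K) (ULift.{u} ℤ) (F.LocalPoint 𝒪[L]) where
  smul_comm σ n x := smul_comm σ n.down x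

/-- `H^i(Gal(L/K), F(m_L))`, the group cohomology of the Galois module `F(m_L)`. The ring of
coefficients `ULift ℤ` is the ring of integers in the universe of `L`. -/
noncomputable def galoisCohomology (i : ℕ) : ModuleCat.{u} (ULift.{u} ℤ) :=
  groupCohomology
    (Rep.ofDistribMulAction (ULift.{u} ℤ) Gal(L/K) (F.LocalPoint 𝒪[L])) i

end FormalGroup

/-!
Write `A_n = F(m_L ^ n)` for the filtration of `A = F(m_L)`; addition in `A_n` agrees with addition
in `L` modulo `m_L ^ (n + 1)`. Let `g` generate the Galois group, let `q` be the order of the first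
ramification group `G_1` and let `d` be its index, so that `g ^ d` generates `G_1`. Because `G_2` is
trivial, `G_1` is killed by the residue characteristic `p`; being cyclic it has order `q = 1` or
`q = p`. The vanishing of Tate cohomology means that `g - 1` and the norm `1 + g + g ^ 2 + ⋯` are
exact at each other on `A`. By completeness (`AddSubgroup.exact_of_exactOn`) this can be checked on
the quotients `A_n ⧸ A_{n + q}` with `n ≡ 1` modulo `q`.

Suppose `q = p` and put `s = g ^ d`. Since `s` lies in `G_1` and not in `G_2`, the map `s - 1` sends
`A_j ⧸ A_{j+1}` isomorphically onto `A_{j+1} ⧸ A_{j+2}` whenever `p` does not divide `j`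
(`IsLocalRing.mem_pow_succ_of_smul_sub_mem`, `IsLocalRing.exists_sub_smul_sub_mem`). In particular
an element fixed by `s` has valuation divisible by `p`, so `m_K` is contained in `m_L ^ p`. The height
enters here: as it is at least two, the coefficients of `[p](X)` of degree at most `p` lie in `m_K`,
and therefore `p` kills `A_n ⧸ A_{n + p}` (`FormalGroup.LocalPoint.nsmul_mem_level`). On this
quotient the norm `1 + s + ⋯ + s ^ (p - 1)` of `G_1` is then `(s - 1) ^ (p - 1)`, and the chain of
isomorphisms identifies its image with the kernel of `s - 1`, namely `A_{n+p-1}`, and its kernel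
with the image of `s - 1`, namely `A_{n+1}` (`AddSubgroup.exactOn_of_jumps`).

What remains is the quotient by `G_1`, acting on one graded piece (`A_{n+p-1} ⧸ A_{n+p}` if `q = p`,
`A_n ⧸ A_{n+1}` if `q = 1`). The inertia subgroup of this quotient has order prime to `p`, so by
independence of characters some integer of `L` has partial trace `1` modulo `m_L`
(`IsLocalRing.exists_sum_pow_smul_sub_one_mem`), and averaging against it gives exactness
(`FormalGroup.LocalPoint.exactOn_level`). The two steps are combined in
`AddSubgroup.exactOn_of_subgroup`, and the cohomology of a finite cyclic group is periodic.
-/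

/-! ### Exactness relative to a filtration of an abelian group -/

theorem Finset.sum_range_mul_eq {M : Type*} [AddCommMonoid M] (f : ℕ → M) (d q : ℕ) :
    ∑ k ∈ Finset.range (d * q), f k =
      ∑ j ∈ Finset.range q, ∑ i ∈ Finset.range d, f (d * j + i) := by
  induction q with
  | zero => simp
  | succ q ih => rw [Nat.mul_succ, Finset.sum_range_add, ih, Finset.sum_range_succ]

theorem geom_sum_range_mul {R : Type*} [Semiring R] (x : R) (d q : ℕ) :
    ∑ k ∈ Finset.range (d * q), x ^ k =
      (∑ i ∈ Finset.range d, x ^ i) * ∑ j ∈ Finset.range q, (x ^ d) ^ j := by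
  rw [Finset.sum_range_mul_eq, Finset.mul_sum]
  refine Finset.sum_congr rfl fun j _ => ?_
  rw [Finset.sum_mul]
  refine Finset.sum_congr rfl fun i _ => ?_
  rw [← pow_mul, ← pow_add, add_comm]

/-- In characteristic `p` one has `1 + X + ⋯ + X ^ (p - 1) = (X - 1) ^ (p - 1)`. -/
theorem Polynomial.exists_geom_sum_eq (p : ℕ) [hp : Fact p.Prime] :
    ∃ Q : Polynomial ℤ, ∑ j ∈ Finset.range p, (X : Polynomial ℤ) ^ j =
      (X - 1) ^ (p - 1) + (p : Polynomial ℤ) * Q := by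
  have h : (X - 1 : Polynomial (ZMod p)) ≠ 0 := X_sub_C_ne_zero (1 : ZMod p)
  have h1 : ∑ j ∈ Finset.range p, (X : Polynomial (ZMod p)) ^ j = (X - 1) ^ (p - 1) := by
    apply mul_right_cancel₀ h
    rw [geom_sum_mul, ← pow_succ, Nat.sub_add_cancel hp.out.one_le, sub_pow_char, one_pow]
  have h2 : C (p : ℤ) ∣ ∑ j ∈ Finset.range p, (X : Polynomial ℤ) ^ j - (X - 1) ^ (p - 1) := by
    rw [C_dvd_iff_dvd_coeff]
    intro i
    have h3 := congrArg (fun f => Polynomial.coeff f i) (sub_eq_zero.mpr h1)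
    rw [← ZMod.intCast_zmod_eq_zero_iff_dvd]
    have h4 : (∑ j ∈ Finset.range p, (X : Polynomial (ZMod p)) ^ j - (X - 1) ^ (p - 1)) =
        (∑ j ∈ Finset.range p, (X : Polynomial ℤ) ^ j - (X - 1) ^ (p - 1)).map
          (Int.castRingHom (ZMod p)) := by
      simp [Polynomial.map_sum]
    simp only [h4, coeff_map, coeff_zero] at h3
    simpa using h3
  obtain ⟨Q, hQ⟩ := h2
  refine ⟨Q, ?_⟩
  rw [sub_eq_iff_eq_add'] at hQ
  rw [hQ]
  simp

theorem AddMonoid.End.mul_apply' {A : Type*} [AddCommGroup A] (f g : AddMonoid.End A) (x : A) :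
    (f * g) x = f (g x) := rfl

theorem AddMonoid.End.sum_apply {A ι : Type*} [AddCommGroup A] (t : Finset ι)
    (f : ι → AddMonoid.End A) (x : A) : (∑ i ∈ t, f i) x = ∑ i ∈ t, f i x :=
  AddMonoidHom.finsetSum_apply f t x

namespace AddSubgroup

variable {A : Type*} [AddCommGroup A]

/-- Two endomorphisms `φ`, `ψ` of an abelian group are exact on the pair `(B, C)` when every
element of `B` that `φ` sends into `C` is congruent modulo `C` to a value of `ψ` on `B`. For
`C ≤ B` stable under both, this says `ker φ ≤ im ψ` on `B ⧸ C`. -/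
def ExactOn (φ ψ : AddMonoid.End A) (B C : AddSubgroup A) : Prop :=
  ∀ x ∈ B, φ x ∈ C → ∃ y ∈ B, x - ψ y ∈ C

/-- Successive approximation: exactness on the graded pieces `B k ⧸ B (k + 1)` of a complete
separated filtration gives exactness on the whole group. Convergence is measured by a second
filtration `D` with `B n ≤ D n`, which `B` may skip steps of. -/
theorem exact_of_exactOn {φ ψ : AddMonoid.End A} {B D : ℕ → AddSubgroup A} (hBD : ∀ n, B n ≤ D n)
    (hB : B 0 = ⊤) (hψ : ∀ n, ∀ x ∈ D n, ψ x ∈ D n)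
    (hcomplete : ∀ y : ℕ → A, (∀ n, y n ∈ D n) →
      ∃ z, ∀ n, z - ∑ i ∈ Finset.range n, y i ∈ D n)
    (hsep : ∀ x, (∀ n, x ∈ D n) → x = 0) (hφψ : φ * ψ = 0)
    (h : ∀ n, ExactOn φ ψ (B n) (B (n + 1))) {x : A} (hx : φ x = 0) : ∃ y, ψ y = x := by
  have hstep : ∀ n (w : A), ∃ y, w ∈ B n → φ w = 0 → y ∈ B n ∧ w - ψ y ∈ B (n + 1) := by
    intro n w
    by_cases hw : w ∈ B n ∧ φ w = 0
    · obtain ⟨y, hy, hy'⟩ := h n w hw.1 (by rw [hw.2]; exact zero_mem _)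
      exact ⟨y, fun _ _ => ⟨hy, hy'⟩⟩
    · exact ⟨0, fun h1 h2 => absurd ⟨h1, h2⟩ hw⟩
  choose f hf using hstep
  let w : ℕ → A := fun n => n.rec x fun n v => v - ψ (f n v)
  have hw : ∀ n, w (n + 1) = w n - ψ (f n (w n)) := fun n => rfl
  have hker : ∀ n, w n ∈ B n ∧ φ (w n) = 0 := by
    intro n
    induction n with
    | zero => exact ⟨by rw [hB]; trivial, hx⟩
    | succ n ih =>
      refine ⟨(hf n _ ih.1 ih.2).2, ?_⟩
      rw [hw, map_sub, ih.2, zero_sub, neg_eq_zero]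
      exact DFunLike.congr_fun hφψ _
  have hsum : ∀ n, x - ψ (∑ i ∈ Finset.range n, f i (w i)) = w n := by
    intro n
    induction n with
    | zero => simp [w]
    | succ n ih => rw [Finset.sum_range_succ, map_add, hw, ← ih]; abel
  obtain ⟨z, hz⟩ := hcomplete (fun n => f n (w n)) fun n =>
    hBD n (hf n _ (hker n).1 (hker n).2).1
  refine ⟨z, (sub_eq_zero.mp (hsep _ fun n => ?_)).symm⟩
  have h1 := sub_mem (hBD n (hker n).1) (hψ n _ (hz n))
  rw [← hsum n] at h1
  convert h1 using 1
  rw [map_sub]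
  abel

theorem aeval_mem {B : AddSubgroup A} {s : AddMonoid.End A} (hs : ∀ x ∈ B, s x ∈ B)
    (Q : Polynomial ℤ) {x : A} (hx : x ∈ B) : (Polynomial.aeval s Q) x ∈ B := by
  have hpow : ∀ n : ℕ, (s ^ n) x ∈ B := by
    intro n
    induction n with
    | zero => simpa
    | succ n ih => rw [pow_succ']; exact hs _ ih
  induction Q using Polynomial.induction_on' with
  | add f g hf hg => rw [map_add]; exact add_mem hf hg
  | monomial n a =>
    rw [Polynomial.aeval_monomial, eq_intCast, AddMonoid.End.mul_apply']
    exact zsmul_mem (hpow n) a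

/-- The quotients of a filtration by jumps of a wildly ramified automorphism `s` of prime order `p`.
If `p` kills `D n ⧸ D (n + p)`, then `1 + s + ⋯ + s ^ (p - 1)` acts on it as `(s - 1) ^ (p - 1)`; if
moreover `n ≡ 1` modulo `p` and `s - 1` maps `D j ⧸ D (j + 1)` isomorphically onto
`D (j + 1) ⧸ D (j + 2)` for all `j` prime to `p`, then the kernel and the image of
`(s - 1) ^ (p - 1)` and of `s - 1` on the quotient are steps of the filtration. -/
theorem exactOn_of_jumps {D : ℕ → AddSubgroup A} (hD : Antitone D) {s : AddMonoid.End A} {p : ℕ}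
    [hp : Fact p.Prime] {n : ℕ} (hn : 0 < n) (hnp : n ≡ 1 [MOD p])
    (hs : ∀ j, ∀ x ∈ D j, s x - x ∈ D (j + 1))
    (hinj : ∀ j, ¬ p ∣ j → ∀ x ∈ D j, s x - x ∈ D (j + 2) → x ∈ D (j + 1))
    (hsurj : ∀ j, 0 < j → ¬ p ∣ j → ∀ y ∈ D (j + 1), ∃ x ∈ D j, y - (s x - x) ∈ D (j + 2))
    (hpD : ∀ x ∈ D n, p • x ∈ D (n + p)) :
    (∀ x ∈ D n, s x - x ∈ D (n + p) → x ∈ D (n + p - 1)) ∧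
    (∀ x ∈ D n, (∑ j ∈ Finset.range p, s ^ j) x ∈ D (n + p - 1)) ∧
    (∀ w ∈ D (n + p - 1), ∃ x ∈ D n, w - (∑ j ∈ Finset.range p, s ^ j) x ∈ D (n + p)) ∧
    (∀ x ∈ D n, (∑ j ∈ Finset.range p, s ^ j) x ∈ D (n + p) →
      ∃ z ∈ D n, x - (s z - z) ∈ D (n + p)) := by
  have hp1 := hp.out.one_lt
  have hndvd : ∀ i, i + 1 < p → ¬ p ∣ n + i := by
    intro i hi hdvd
    have h1 : n + i ≡ 1 + i [MOD p] := hnp.add_right i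
    have h2 : 1 + i ≡ 0 [MOD p] := h1.symm.trans ((Nat.modEq_zero_iff_dvd).mpr hdvd)
    have h3 := Nat.le_of_dvd (by omega) ((Nat.modEq_zero_iff_dvd).mp h2)
    omega
  have hstab : ∀ j, ∀ x ∈ D j, s x ∈ D j := fun j x hx => by
    simpa using add_mem (hD (Nat.le_succ j) (hs j x hx)) hx
  have hpow : ∀ i, ∀ x ∈ D n, ((s - 1) ^ i) x ∈ D (n + i) := by
    intro i x hx
    induction i with
    | zero => simpa
    | succ i ih => rw [pow_succ']; exact hs _ _ ih
  have hN : ∀ x ∈ D n,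
      (∑ j ∈ Finset.range p, s ^ j) x - ((s - 1) ^ (p - 1)) x ∈ D (n + p) := by
    intro x hx
    obtain ⟨Q, hQ⟩ := Polynomial.exists_geom_sum_eq p
    have h := congrArg (fun f => (Polynomial.aeval s f) x) hQ
    simp only [map_sum, map_pow, map_add, map_sub, map_mul, Polynomial.aeval_X, map_one,
      map_natCast] at h
    have h' : (∑ j ∈ Finset.range p, s ^ j) x - ((s - 1) ^ (p - 1)) x =
        p • (Polynomial.aeval s Q) x := by
      rw [h, sub_eq_iff_eq_add']
      exact congrArg (((s - 1) ^ (p - 1)) x + ·) (AddMonoid.End.natCast_apply p _)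
    rw [h']
    exact hpD _ (aeval_mem (hstab n) Q hx)
  -- the kernel of `s - 1`
  have hker : ∀ x ∈ D n, s x - x ∈ D (n + p) → x ∈ D (n + p - 1) := by
    intro x hx hsx
    have h : ∀ i, i + 1 ≤ p → x ∈ D (n + i) := by
      intro i
      induction i with
      | zero => intro _; exact hx
      | succ i ih =>
        intro hi
        exact hinj _ (hndvd i (by omega)) x (ih (by omega)) (hD (by omega) hsx)
    exact hD (by omega) (h (p - 1) (by omega))
  -- the kernel of `(s - 1) ^ (p - 1)`
  have hkerpow : ∀ i, i + 1 ≤ p → ∀ x ∈ D n, ((s - 1) ^ i) x ∈ D (n + i + 1) → x ∈ D (n + 1) := by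
    intro i
    induction i with
    | zero => intro _ x _ h; simpa using h
    | succ i ih =>
      intro hi x hx h
      refine ih (by omega) x hx (hinj _ (hndvd i (by omega)) _ (hpow i x hx) ?_)
      rw [pow_succ'] at h
      exact h
  -- the images of `s - 1` and of `(s - 1) ^ (p - 1)`
  have him : ∀ y ∈ D (n + 1), ∃ z ∈ D n, y - (s z - z) ∈ D (n + p) := by
    intro y hy
    have h : ∀ i, i + 1 ≤ p → ∃ z ∈ D n, y - (s z - z) ∈ D (n + i + 1) := by
      intro i
      induction i with
      | zero => intro _; exact ⟨0, zero_mem _, by simpa using hy⟩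
      | succ i ih =>
        intro hi
        obtain ⟨z, hz, hz'⟩ := ih (by omega)
        obtain ⟨z₁, hz₁, hz₁'⟩ := hsurj _ (by omega) (hndvd i (by omega)) _ hz'
        refine ⟨z + z₁, add_mem hz (hD (Nat.le_add_right n i) hz₁), ?_⟩
        have e : y - (s (z + z₁) - (z + z₁)) = y - (s z - z) - (s z₁ - z₁) := by
          rw [map_add]
          abel
        rw [e]
        exact hz₁'
    obtain ⟨z, hz, hz'⟩ := h (p - 1) (by omega)
    exact ⟨z, hz, hD (by omega) hz'⟩
  have himpow : ∀ i, i + 1 ≤ p → ∀ w ∈ D (n + i), ∃ x ∈ D n,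
      w - ((s - 1) ^ i) x ∈ D (n + i + 1) := by
    intro i
    induction i with
    | zero => intro _ w hw; exact ⟨w, hw, by simp⟩
    | succ i ih =>
      intro hi w hw
      obtain ⟨y, hy, hy'⟩ := hsurj _ (by omega) (hndvd i (by omega)) w hw
      obtain ⟨x, hx, hx'⟩ := ih (by omega) y hy
      refine ⟨x, hx, ?_⟩
      have h := add_mem hy' (hs _ _ hx')
      have e : w - ((s - 1) ^ (i + 1)) x =
          w - (s y - y) + (s (y - ((s - 1) ^ i) x) - (y - ((s - 1) ^ i) x)) := by
        rw [pow_succ', AddMonoid.End.mul_apply', map_sub]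
        change w - (s (((s - 1) ^ i) x) - ((s - 1) ^ i) x) = _
        abel
      rw [e]
      exact h
  refine ⟨hker, fun x hx => ?_, fun w hw => ?_, fun x hx hNx => ?_⟩
  · have h1 := hD (show n + (p - 1) ≤ n + p by omega) (hN x hx)
    have h2 := add_mem h1 (hpow (p - 1) x hx)
    rw [sub_add_cancel] at h2
    exact hD (by omega) h2
  · obtain ⟨x, hx, hx'⟩ := himpow (p - 1) (by omega) w (hD (by omega) hw)
    refine ⟨x, hx, ?_⟩
    have h := sub_mem (hD (show n + p ≤ n + (p - 1) + 1 by omega) hx') (hN x hx)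
    convert h using 1
    abel
  · refine him x (hkerpow (p - 1) (by omega) x hx ?_)
    have h := sub_mem hNx (hN x hx)
    rw [sub_sub_cancel] at h
    exact hD (by omega) h

/-- Exactness for a cyclic group from exactness for a subgroup and for the quotient: `g` generates
the group, `s = g ^ d` the subgroup of order `q`, and `W` is the group of `s`-invariants modulo
`C`. -/
theorem exactOn_of_subgroup {g : AddMonoid.End A} {d q : ℕ} {B C W : AddSubgroup A}
    (hgB : ∀ x ∈ B, g x ∈ B) (hgC : ∀ x ∈ C, g x ∈ C)
    (hinv : ∀ x ∈ B, (g ^ d) x - x ∈ C → x ∈ W)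
    (hnorm : ∀ x ∈ B, (∑ j ∈ Finset.range q, (g ^ d) ^ j) x ∈ W)
    (hsurj : ∀ w ∈ W, ∃ x ∈ B, w - (∑ j ∈ Finset.range q, (g ^ d) ^ j) x ∈ C)
    (hker : ∀ x ∈ B, (∑ j ∈ Finset.range q, (g ^ d) ^ j) x ∈ C →
      ∃ z ∈ B, x - ((g ^ d) z - z) ∈ C)
    (h₁ : ExactOn (g - 1) (∑ i ∈ Finset.range d, g ^ i) W C)
    (h₂ : ExactOn (∑ i ∈ Finset.range d, g ^ i) (g - 1) W C) :
    ExactOn (g - 1) (∑ i ∈ Finset.range (d * q), g ^ i) B C ∧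
      ExactOn (∑ i ∈ Finset.range (d * q), g ^ i) (g - 1) B C := by
  have hpow : ∀ {E : AddSubgroup A}, (∀ x ∈ E, g x ∈ E) → ∀ (i : ℕ), ∀ x ∈ E, (g ^ i) x ∈ E := by
    intro E hE i x hx
    induction i with
    | zero => simpa
    | succ i ih => rw [pow_succ']; exact hE _ ih
  have hsum : ∀ {E : AddSubgroup A}, (∀ x ∈ E, g x ∈ E) → ∀ x ∈ E,
      (∑ i ∈ Finset.range d, g ^ i) x ∈ E := by
    intro E hE x hx
    rw [AddMonoid.End.sum_apply]
    exact sum_mem fun i _ => hpow hE i x hx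
  have hgd : g ^ d - 1 = (g - 1) * ∑ i ∈ Finset.range d, g ^ i := (mul_geom_sum g d).symm
  have hgd' : g ^ d - 1 = (∑ i ∈ Finset.range d, g ^ i) * (g - 1) := (geom_sum_mul g d).symm
  constructor
  · intro x hx hgx
    have hxW : x ∈ W := by
      refine hinv x hx ?_
      have h : (g ^ d - 1) x ∈ C := by
        rw [hgd']
        exact hsum hgC _ hgx
      exact h
    obtain ⟨w, hw, hxw⟩ := h₁ x hxW hgx
    obtain ⟨y, hy, hwy⟩ := hsurj w hw
    refine ⟨y, hy, ?_⟩
    have h := add_mem hxw (hsum hgC _ hwy)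
    rw [geom_sum_range_mul, AddMonoid.End.mul_apply']
    convert h using 1
    rw [map_sub]
    abel
  · intro x hx hNx
    rw [geom_sum_range_mul, AddMonoid.End.mul_apply'] at hNx
    obtain ⟨w, hw, hxw⟩ := h₂ _ (hnorm x hx) hNx
    obtain ⟨y, hy, hwy⟩ := hsurj w hw
    have hcomm : (∑ j ∈ Finset.range q, (g ^ d) ^ j) * (g - 1) =
        (g - 1) * ∑ j ∈ Finset.range q, (g ^ d) ^ j := by
      refine Commute.sum_left _ _ _ fun j _ => ?_
      exact (((Commute.refl g).pow_left d).pow_left j).sub_right (Commute.one_right _)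
    have hgsub : ∀ {E : AddSubgroup A}, (∀ x ∈ E, g x ∈ E) → ∀ x ∈ E, (g - 1) x ∈ E :=
      fun hE x hx => sub_mem (hE x hx) hx
    obtain ⟨z, hz, hz'⟩ := hker (x - (g - 1) y) (sub_mem hx (hgsub hgB y hy)) (by
      have h := add_mem hxw (hgsub hgC _ hwy)
      convert h using 1
      rw [map_sub, ← AddMonoid.End.mul_apply', hcomm, AddMonoid.End.mul_apply', map_sub (g - 1)]
      abel)
    refine ⟨y + (∑ i ∈ Finset.range d, g ^ i) z, add_mem hy (hsum hgB z hz), ?_⟩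
    have h : (g ^ d) z - z = (g - 1) ((∑ i ∈ Finset.range d, g ^ i) z) := by
      rw [← AddMonoid.End.mul_apply', ← hgd]
      rfl
    rw [map_add, ← h]
    convert hz' using 1
    abel

end AddSubgroup

/-! ### Ramification groups of a discrete valuation ring with perfect residue field -/

namespace IsLocalRing

theorem smul_mem_maximalIdeal {S G : Type*} [CommRing S] [IsLocalRing S] [Group G]
    [MulSemiringAction G S] (g : G) {x : S} (hx : x ∈ maximalIdeal S) :
    g • x ∈ maximalIdeal S := fun h =>
  hx (by simpa using h.map (MulSemiringAction.toRingHom G S g⁻¹))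

theorem smul_mem_maximalIdeal_pow {S G : Type*} [CommRing S] [IsLocalRing S] [Group G]
    [MulSemiringAction G S] (g : G) {n : ℕ} {x : S} (hx : x ∈ maximalIdeal S ^ n) :
    g • x ∈ maximalIdeal S ^ n := by
  have h : (maximalIdeal S ^ n).map (MulSemiringAction.toRingHom G S g) ≤ maximalIdeal S ^ n := by
    rw [Ideal.map_pow]
    refine Ideal.pow_right_mono (Ideal.map_le_iff_le_comap.mpr fun y hy => ?_) n
    exact smul_mem_maximalIdeal g hy
  exact h (Ideal.mem_map_of_mem (MulSemiringAction.toRingHom G S g) hx)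

variable {S G : Type*} [CommRing S] [IsDomain S] [IsDiscreteValuationRing S] [Group G]
  [MulSemiringAction G S]

theorem mem_maximalIdeal_of_irreducible {ϖ : S} (hϖ : Irreducible ϖ) : ϖ ∈ maximalIdeal S :=
  hϖ.not_isUnit

theorem mem_maximalIdeal_pow_iff {ϖ : S} (hϖ : Irreducible ϖ) (n : ℕ) (x : S) :
    x ∈ maximalIdeal S ^ n ↔ ∃ u, x = ϖ ^ n * u := by
  rw [hϖ.maximalIdeal_eq, Ideal.span_singleton_pow, Ideal.mem_span_singleton]
  rfl

/-- An element of the first ramification group acts trivially on the graded pieces of the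
filtration by powers of the maximal ideal. -/
theorem smul_sub_mem_pow_succ {s : G} (hs : ∀ x : S, s • x - x ∈ maximalIdeal S ^ 2) {n : ℕ}
    {x : S} (hx : x ∈ maximalIdeal S ^ n) : s • x - x ∈ maximalIdeal S ^ (n + 1) := by
  induction n generalizing x with
  | zero => exact Ideal.pow_le_pow_right (by norm_num) (hs x)
  | succ n ih =>
    rw [pow_succ] at hx
    induction hx using Submodule.mul_induction_on' with
    | mem_mul_mem a ha b hb =>
      have h : s • (a * b) - a * b = (s • a - a) * s • b + a * (s • b - b) := by
        rw [smul_mul']; ring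
      rw [h]
      refine add_mem ?_ ?_
      · rw [pow_succ]
        refine Ideal.mul_mem_mul (ih ha) ?_
        rw [← pow_one (maximalIdeal S)] at hb ⊢
        exact smul_mem_maximalIdeal_pow s hb
      · rw [show n + 1 + 1 = n + 2 from rfl, pow_add]
        exact Ideal.mul_mem_mul ha (hs b)
    | add a _ b _ ha hb =>
      rw [smul_add, add_sub_add_comm]
      exact add_mem ha hb

/-- If the residue field is perfect, an element of a higher ramification group lies in the next one
as soon as it fixes a uniformizer to the required order: it fixes `p`-th powers to that order, and
every element is a `p`-th power up to a multiple of the uniformizer. -/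
theorem smul_sub_mem_of_uniformizer {p : ℕ} (hp : p.Prime) (hpm : (p : S) ∈ maximalIdeal S)
    (hperf : ∀ x : S, ∃ y, x - y ^ p ∈ maximalIdeal S) {ϖ : S} (hϖ : Irreducible ϖ) {s : G} {i : ℕ}
    (hi : 0 < i) (hs : ∀ x : S, s • x - x ∈ maximalIdeal S ^ i)
    (hsϖ : s • ϖ - ϖ ∈ maximalIdeal S ^ (i + 1)) (x : S) :
    s • x - x ∈ maximalIdeal S ^ (i + 1) := by
  have hϖm := mem_maximalIdeal_of_irreducible hϖ
  obtain ⟨y, hy⟩ := hperf x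
  obtain ⟨u, hu⟩ : ∃ u, x - y ^ p = ϖ ^ 1 * u :=
    (mem_maximalIdeal_pow_iff hϖ 1 _).mp (by rwa [pow_one])
  rw [pow_one] at hu
  -- `(y + δ) ^ p - y ^ p = δ ^ p + p * (⋯)` for `δ = s • y - y`
  obtain ⟨r, hr⟩ := exists_add_pow_prime_eq hp y (s • y - y)
  rw [add_sub_cancel] at hr
  have h : s • x - x = (s • y - y) ^ p + (p : S) * (s • y - y) * (y * r) +
      ((s • u - u) * s • ϖ + u * (s • ϖ - ϖ)) := by
    rw [sub_eq_iff_eq_add.mp hu, smul_add, smul_pow', hr, smul_mul']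
    ring
  have hsϖ' : s • ϖ ∈ maximalIdeal S := smul_mem_maximalIdeal s hϖm
  rw [h]
  refine add_mem (add_mem ?_ ?_) (add_mem ?_ (Ideal.mul_mem_left _ _ hsϖ))
  · refine Ideal.pow_le_pow_right (m := i + 1) (n := i * p) ?_ ?_
    · nlinarith [hp.two_le]
    · rw [pow_mul]; exact Ideal.pow_mem_pow (hs y) p
  · refine Ideal.mul_mem_right _ _ ?_
    rw [pow_succ']
    exact Ideal.mul_mem_mul hpm (hs y)
  · rw [pow_succ]
    exact Ideal.mul_mem_mul (hs u) hsϖ'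

/-- The tame quotient has no elements of order `p`. -/
theorem smul_sub_mem_sq_of_pow {p : ℕ} (hp : p.Prime) (hpm : (p : S) ∈ maximalIdeal S)
    (hperf : ∀ x : S, ∃ y, x - y ^ p ∈ maximalIdeal S) {s : G}
    (hs : ∀ x : S, s • x - x ∈ maximalIdeal S)
    (hsp : ∀ x : S, s ^ p • x - x ∈ maximalIdeal S ^ 2) (x : S) :
    s • x - x ∈ maximalIdeal S ^ 2 := by
  obtain ⟨ϖ, hϖ⟩ := IsDiscreteValuationRing.exists_irreducible S
  have hϖm := mem_maximalIdeal_of_irreducible hϖ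
  refine smul_sub_mem_of_uniformizer hp hpm hperf hϖ one_pos (by simpa using hs) ?_ x
  -- `u` is the value of the tame character at `s`; its `p`-th power is trivial modulo `m`
  obtain ⟨u, hu⟩ : ∃ u, s • ϖ = ϖ ^ 1 * u := (mem_maximalIdeal_pow_iff hϖ 1 _).mp (by
    rw [pow_one]; exact smul_mem_maximalIdeal s hϖm)
  rw [pow_one] at hu
  have hpow : ∀ k : ℕ, s ^ k • ϖ - ϖ * u ^ k ∈ maximalIdeal S ^ 2 := by
    intro k
    induction k with
    | zero => simp
    | succ k ih =>
      have h : s ^ (k + 1) • ϖ - ϖ * u ^ (k + 1) =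
          s • (s ^ k • ϖ - ϖ * u ^ k) + ϖ * u * (s • u ^ k - u ^ k) := by
        rw [pow_succ' s, mul_smul, smul_sub, smul_mul', hu]
        ring
      rw [h]
      refine add_mem (smul_mem_maximalIdeal_pow s ih) ?_
      rw [pow_two]
      exact Ideal.mul_mem_mul (Ideal.mul_mem_right _ _ hϖm) (hs _)
  have h1 : ϖ * (u ^ p - 1) ∈ maximalIdeal S ^ 2 := by
    have h := sub_mem (hsp ϖ) (hpow p)
    convert h using 1
    ring
  obtain ⟨v, hv⟩ := (mem_maximalIdeal_pow_iff hϖ 2 _).mp h1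
  have h2 : u ^ p - 1 ∈ maximalIdeal S := by
    rw [pow_two, mul_assoc] at hv
    rw [mul_left_cancel₀ hϖ.ne_zero hv]
    exact Ideal.mul_mem_right _ _ hϖm
  have h3 : u - 1 ∈ maximalIdeal S := by
    obtain ⟨r, hr⟩ := exists_add_pow_prime_eq hp (1 : S) (u - 1)
    rw [add_sub_cancel, one_pow] at hr
    refine Ideal.IsPrime.mem_of_pow_mem (maximalIdeal.isMaximal S).isPrime p ?_
    have h : (u - 1) ^ p = u ^ p - 1 - (p : S) * (1 * (u - 1) * r) := by rw [hr]; ring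
    rw [h]
    exact sub_mem h2 (Ideal.mul_mem_right _ _ hpm)
  have h4 : s • ϖ - ϖ = ϖ * (u - 1) := by rw [hu]; ring
  rw [h4, one_add_one_eq_two, pow_two]
  exact Ideal.mul_mem_mul hϖm h3

/-- The quotient of the first ramification group by the second one is killed by `p`. -/
theorem pow_smul_sub_mem_cube {p : ℕ} (hp : p.Prime) (hpm : (p : S) ∈ maximalIdeal S)
    (hperf : ∀ x : S, ∃ y, x - y ^ p ∈ maximalIdeal S) {s : G}
    (hs : ∀ x : S, s • x - x ∈ maximalIdeal S ^ 2) (x : S) :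
    s ^ p • x - x ∈ maximalIdeal S ^ 3 := by
  obtain ⟨ϖ, hϖ⟩ := IsDiscreteValuationRing.exists_irreducible S
  have hpow : ∀ (k : ℕ) (y : S), s ^ k • y - y ∈ maximalIdeal S ^ 2 := by
    intro k y
    induction k with
    | zero => simp
    | succ k ih =>
      have h := add_mem (hs (s ^ k • y)) ih
      rwa [sub_add_sub_cancel, ← mul_smul, ← pow_succ'] at h
  have hlin : ∀ k : ℕ, s ^ k • ϖ - (ϖ + (k : S) * (s • ϖ - ϖ)) ∈ maximalIdeal S ^ 3 := by
    intro k
    induction k with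
    | zero => simp
    | succ k ih =>
      have h : s ^ (k + 1) • ϖ - (ϖ + ((k + 1 : ℕ) : S) * (s • ϖ - ϖ)) =
          (s • (s ^ k • ϖ - ϖ) - (s ^ k • ϖ - ϖ)) +
            (s ^ k • ϖ - (ϖ + (k : S) * (s • ϖ - ϖ))) := by
        rw [pow_succ', mul_smul, smul_sub]
        push_cast
        ring
      rw [h]
      exact add_mem (smul_sub_mem_pow_succ hs (hpow k ϖ)) ih
  refine smul_sub_mem_of_uniformizer hp hpm hperf hϖ two_pos (hpow p) ?_ x
  have h := add_mem (hlin p) (show (p : S) * (s • ϖ - ϖ) ∈ maximalIdeal S ^ 3 by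
    rw [pow_succ']; exact Ideal.mul_mem_mul hpm (hs ϖ))
  convert h using 1
  ring

theorem isUnit_natCast_of_not_dvd {p : ℕ} (hp : p.Prime) (hpm : (p : S) ∈ maximalIdeal S) {j : ℕ}
    (hj : ¬ p ∣ j) : IsUnit (j : S) := by
  by_contra h
  have h1 : IsCoprime (p : ℤ) (j : ℤ) := Nat.isCoprime_iff_coprime.mpr
    ((Nat.Prime.coprime_iff_not_dvd hp).mpr hj)
  obtain ⟨a, b, hab⟩ := h1
  have h2 : (1 : S) = (a : S) * (p : S) + (b : S) * (j : S) := by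
    have := congrArg (Int.cast : ℤ → S) hab
    push_cast at this
    exact this.symm
  refine (maximalIdeal.isMaximal S).ne_top ((Ideal.eq_top_iff_one _).mpr ?_)
  rw [h2]
  exact add_mem (Ideal.mul_mem_left _ _ hpm) (Ideal.mul_mem_left _ _ h)

/-- The leading term of `s - 1` for an element `s` of the first ramification group, in terms of its
value at a uniformizer. -/
theorem smul_uniformizer_pow_sub {s : G} (hs : ∀ x : S, s • x - x ∈ maximalIdeal S ^ 2) {ϖ ε : S}
    (hϖ : Irreducible ϖ) (hε : s • ϖ - ϖ = ϖ ^ 2 * ε) (j : ℕ) (u : S) :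
    s • (ϖ ^ j * u) - ϖ ^ j * u - ϖ ^ (j + 1) * ((j : S) * ε * u) ∈ maximalIdeal S ^ (j + 2) := by
  have hϖm := mem_maximalIdeal_of_irreducible hϖ
  have hsϖ : s • ϖ = ϖ + ϖ ^ 2 * ε := by rw [← hε]; ring
  induction j with
  | zero => simpa using hs u
  | succ j ih =>
    have h : s • (ϖ ^ (j + 1) * u) - ϖ ^ (j + 1) * u -
        ϖ ^ (j + 1 + 1) * (((j + 1 : ℕ) : S) * ε * u) =
        ϖ * (1 + ϖ * ε) * (s • (ϖ ^ j * u) - ϖ ^ j * u - ϖ ^ (j + 1) * ((j : S) * ε * u)) +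
          ϖ ^ (j + 1 + 2) * ((j : S) * ε ^ 2 * u) := by
      rw [pow_succ' ϖ j, mul_assoc, smul_mul', hsϖ]
      push_cast
      ring
    rw [h]
    refine add_mem ?_ (Ideal.mul_mem_right _ _ (Ideal.pow_mem_pow hϖm _))
    rw [show j + 1 + 2 = (j + 2) + 1 by ring, pow_succ']
    exact Ideal.mul_mem_mul (Ideal.mul_mem_right _ _ hϖm) ih

/-- An element outside the second ramification group moves a uniformizer to exact order two. -/
theorem exists_smul_uniformizer_sub {p : ℕ} (hp : p.Prime) (hpm : (p : S) ∈ maximalIdeal S)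
    (hperf : ∀ x : S, ∃ y, x - y ^ p ∈ maximalIdeal S) {s : G}
    (hs : ∀ x : S, s • x - x ∈ maximalIdeal S ^ 2)
    (hs3 : ¬ ∀ x : S, s • x - x ∈ maximalIdeal S ^ 3) {ϖ : S} (hϖ : Irreducible ϖ) :
    ∃ ε, IsUnit ε ∧ s • ϖ - ϖ = ϖ ^ 2 * ε := by
  obtain ⟨ε, hε⟩ := (mem_maximalIdeal_pow_iff hϖ 2 _).mp (hs ϖ)
  refine ⟨ε, ?_, hε⟩
  by_contra h
  refine hs3 fun x => smul_sub_mem_of_uniformizer hp hpm hperf hϖ two_pos hs ?_ x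
  have hϖm := mem_maximalIdeal_of_irreducible hϖ
  rw [hε, pow_succ]
  exact Ideal.mul_mem_mul (Ideal.pow_mem_pow hϖm 2) h

/-- `s - 1` is injective from the graded piece of degree `j` to the next one when `p` does not
divide `j`. -/
theorem mem_pow_succ_of_smul_sub_mem {p : ℕ} (hp : p.Prime) (hpm : (p : S) ∈ maximalIdeal S)
    (hperf : ∀ x : S, ∃ y, x - y ^ p ∈ maximalIdeal S) {s : G}
    (hs : ∀ x : S, s • x - x ∈ maximalIdeal S ^ 2)
    (hs3 : ¬ ∀ x : S, s • x - x ∈ maximalIdeal S ^ 3) {j : ℕ} (hj : ¬ p ∣ j) {x : S}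
    (hx : x ∈ maximalIdeal S ^ j) (hsx : s • x - x ∈ maximalIdeal S ^ (j + 2)) :
    x ∈ maximalIdeal S ^ (j + 1) := by
  obtain ⟨ϖ, hϖ⟩ := IsDiscreteValuationRing.exists_irreducible S
  obtain ⟨ε, hεu, hε⟩ := exists_smul_uniformizer_sub hp hpm hperf hs hs3 hϖ
  obtain ⟨u, rfl⟩ := (mem_maximalIdeal_pow_iff hϖ j x).mp hx
  have h := sub_mem hsx (smul_uniformizer_pow_sub hs hϖ hε j u)
  rw [sub_sub_cancel] at h
  obtain ⟨v, hv⟩ := (mem_maximalIdeal_pow_iff hϖ _ _).mp h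
  rw [show j + 2 = j + 1 + 1 from rfl, pow_succ ϖ (j + 1), mul_assoc (ϖ ^ (j + 1))] at hv
  have h1 := mul_left_cancel₀ (pow_ne_zero _ hϖ.ne_zero) hv
  obtain ⟨w, hw⟩ := ((isUnit_natCast_of_not_dvd hp hpm hj).mul hεu).exists_left_inv
  refine (mem_maximalIdeal_pow_iff hϖ _ _).mpr ⟨w * v, ?_⟩
  rw [pow_succ, mul_assoc]
  congr 1
  calc u = w * ((j : S) * ε) * u := by rw [hw, one_mul]
    _ = w * ((j : S) * ε * u) := by ring
    _ = ϖ * (w * v) := by rw [h1]; ring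

/-- `s - 1` is surjective from the graded piece of degree `j` to the next one when `p` does not
divide `j`. -/
theorem exists_sub_smul_sub_mem {p : ℕ} (hp : p.Prime) (hpm : (p : S) ∈ maximalIdeal S)
    (hperf : ∀ x : S, ∃ y, x - y ^ p ∈ maximalIdeal S) {s : G}
    (hs : ∀ x : S, s • x - x ∈ maximalIdeal S ^ 2)
    (hs3 : ¬ ∀ x : S, s • x - x ∈ maximalIdeal S ^ 3) {j : ℕ} (hj : ¬ p ∣ j) {y : S}
    (hy : y ∈ maximalIdeal S ^ (j + 1)) :
    ∃ x ∈ maximalIdeal S ^ j, y - (s • x - x) ∈ maximalIdeal S ^ (j + 2) := by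
  obtain ⟨ϖ, hϖ⟩ := IsDiscreteValuationRing.exists_irreducible S
  obtain ⟨ε, hεu, hε⟩ := exists_smul_uniformizer_sub hp hpm hperf hs hs3 hϖ
  obtain ⟨v, rfl⟩ := (mem_maximalIdeal_pow_iff hϖ (j + 1) y).mp hy
  obtain ⟨w, hw⟩ := ((isUnit_natCast_of_not_dvd hp hpm hj).mul hεu).exists_right_inv
  refine ⟨ϖ ^ j * (w * v), (mem_maximalIdeal_pow_iff hϖ _ _).mpr ⟨_, rfl⟩, ?_⟩
  have h := neg_mem (smul_uniformizer_pow_sub hs hϖ hε j (w * v))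
  convert h using 1
  rw [← mul_assoc ((j : S) * ε) w v, hw]
  ring

/-- A nonunit fixed by an element of the first ramification group that is not in the second has
valuation at least `p`: its class in a graded piece of smaller degree is killed by `s - 1`, which is
injective there. -/
theorem mem_pow_of_smul_eq {p : ℕ} (hp : p.Prime) (hpm : (p : S) ∈ maximalIdeal S)
    (hperf : ∀ x : S, ∃ y, x - y ^ p ∈ maximalIdeal S) {s : G}
    (hs : ∀ x : S, s • x - x ∈ maximalIdeal S ^ 2)
    (hs3 : ¬ ∀ x : S, s • x - x ∈ maximalIdeal S ^ 3) {x : S} (hx : x ∈ maximalIdeal S)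
    (hsx : s • x = x) : x ∈ maximalIdeal S ^ p := by
  have h : ∀ j, 0 < j → j ≤ p → x ∈ maximalIdeal S ^ j := by
    intro j hj
    induction j, hj using Nat.le_induction with
    | base => intro _; simpa
    | succ j hj ih =>
      intro hjp
      refine mem_pow_succ_of_smul_sub_mem hp hpm hperf hs hs3 ?_ (ih (by omega)) (by simp [hsx])
      exact fun hdvd => absurd (Nat.le_of_dvd hj hdvd) (by omega)
  exact h p hp.pos le_rfl

end IsLocalRing

theorem Subgroup.exists_pow_mem_iff_dvd {G : Type*} [Group G] (H : Subgroup G) {g : G}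
    (hg : IsOfFinOrder g) : ∃ d, 0 < d ∧ ∀ k : ℕ, g ^ k ∈ H ↔ d ∣ k := by
  classical
  have hex : ∃ d, 0 < d ∧ g ^ d ∈ H :=
    ⟨orderOf g, hg.orderOf_pos, by rw [pow_orderOf_eq_one]; exact one_mem H⟩
  have hmem := (Nat.find_spec hex).2
  refine ⟨Nat.find hex, (Nat.find_spec hex).1, fun k => ⟨fun hk => ?_, ?_⟩⟩
  · by_contra hdvd
    have hpos : 0 < k % Nat.find hex := Nat.pos_of_ne_zero fun h => hdvd (Nat.dvd_of_mod_eq_zero h)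
    refine Nat.find_min hex (Nat.mod_lt k (Nat.find_spec hex).1) ⟨hpos, ?_⟩
    rw [← Nat.div_add_mod k (Nat.find hex), pow_add, pow_mul] at hk
    exact (H.mul_mem_cancel_left (pow_mem hmem _)).mp hk
  · rintro ⟨j, rfl⟩
    rw [pow_mul]
    exact pow_mem hmem j

namespace IsLocalRing

/-! ### The tame quotient -/

section Tame

variable {S G : Type*} [CommRing S] [IsLocalRing S] [Group G] [MulSemiringAction G S]

/-- Distinct automorphisms of the residue field are linearly independent, so the partial trace
over the tame quotient, whose ramification index is prime to `p`, does not vanish modulo the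
maximal ideal; it can then be normalized to take the value `1`. The hypothesis `htame` says that
the inertia of the quotient of `⟨g⟩` by `⟨g ^ d⟩` has no elements of order `p`. -/
theorem exists_sum_pow_smul_sub_one_mem {p : ℕ} (hp : p.Prime) (hpm : (p : S) ∈ maximalIdeal S)
    {g : G} (hg : IsOfFinOrder g) {d : ℕ} (hd : 0 < d)
    (hgd : ∀ x : S, g ^ d • x - x ∈ maximalIdeal S)
    (htame : ∀ k : ℕ, (∀ x : S, g ^ k • x - x ∈ maximalIdeal S) → d ∣ k * p → d ∣ k) :
    ∃ c : S, ∑ i ∈ Finset.range d, g ^ i • c - 1 ∈ maximalIdeal S := by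
  obtain ⟨f, hf, hfk⟩ := ((maximalIdeal S).toAddSubgroup.inertia G).exists_pow_mem_iff_dvd hg
  obtain ⟨e, rfl⟩ : f ∣ d := (hfk d).mp hgd
  have he : 0 < e := Nat.pos_of_ne_zero (by rintro rfl; simp at hd)
  -- `f` is the order of the image of `g` in the automorphisms of the residue field, and `e` is the
  -- order of the tame part of inertia
  have hpe : ¬ p ∣ e := by
    rintro ⟨a, rfl⟩
    have ha : 0 < a := Nat.pos_of_ne_zero (by rintro rfl; simp at he)
    have h1 := htame (f * a) ((hfk _).mpr (dvd_mul_right f a)) ⟨1, by ring⟩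
    have h2 := Nat.le_of_dvd (Nat.mul_pos hf ha) h1
    have h3 : f * a * 2 ≤ f * a * p := Nat.mul_le_mul_left _ hp.two_le
    have h4 : 0 < f * a := Nat.mul_pos hf ha
    nlinarith
  have heR : (e : ResidueField S) ≠ 0 := by
    intro h
    obtain ⟨a, b, hab⟩ : IsCoprime (p : ℤ) (e : ℤ) := Nat.isCoprime_iff_coprime.mpr
      ((Nat.Prime.coprime_iff_not_dvd hp).mpr hpe)
    have hp0 : (p : ResidueField S) = 0 := by
      rw [← map_natCast (residue S), residue_eq_zero_iff]; exact hpm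
    have h2 := congrArg (Int.cast : ℤ → ResidueField S) hab
    push_cast at h2
    rw [hp0, h] at h2
    simp at h2
  let χ : ℕ → S →* ResidueField S := fun i =>
    (residue S : S →* ResidueField S).comp (MulSemiringAction.toRingHom G S (g ^ i) : S →* S)
  have hχ : ∀ i x, χ i x = residue S (g ^ i • x) := fun i x => rfl
  have hres : ∀ x y : S, residue S x = residue S y ↔ x - y ∈ maximalIdeal S := fun x y => by
    rw [← sub_eq_zero, ← map_sub, residue_eq_zero_iff]
  have hχinj : ∀ i j, i < f → j < f → i ≤ j → χ i = χ j → i = j := by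
    intro i j _ hj hij h
    have h1 : g ^ (j - i) ∈ (maximalIdeal S).toAddSubgroup.inertia G := by
      intro x
      have h2 := DFunLike.congr_fun h (g⁻¹ ^ i • x)
      rw [hχ, hχ, smul_smul, smul_smul, inv_pow, mul_inv_cancel, one_smul,
        ← pow_sub g hij] at h2
      exact (hres _ _).mp h2.symm
    have h2 := (hfk _).mp h1
    have h3 := Nat.eq_zero_of_dvd_of_lt h2 (by omega)
    omega
  have hχinj' : Function.Injective fun i : Fin f => χ i := by
    intro i j h
    rcases le_total (i : ℕ) j with hij | hij
    · exact Fin.ext (hχinj i j i.2 j.2 hij h)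
    · exact Fin.ext (hχinj j i j.2 i.2 hij h.symm).symm
  have hlin := (linearIndependent_monoidHom S (ResidueField S)).comp _ hχinj'
  have hsum : ∀ x, residue S (∑ i ∈ Finset.range (f * e), g ^ i • x) =
      ∑ i : Fin f, (e : ResidueField S) * χ i x := by
    intro x
    have hperiod : ∀ j i, residue S (g ^ (f * j + i) • x) = χ i x := by
      intro j i
      rw [hχ, pow_add, mul_smul, hres]
      exact (hfk (f * j)).mpr (dvd_mul_right f j) _
    rw [map_sum, Finset.sum_range_mul_eq, ← Finset.mul_sum, Fin.sum_univ_eq_sum_range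
      (fun i => χ i x) f]
    simp [hperiod]
  obtain ⟨c, hc⟩ : ∃ c, residue S (∑ i ∈ Finset.range (f * e), g ^ i • c) ≠ 0 := by
    by_contra! h
    have h1 := Fintype.linearIndependent_iff.mp hlin (fun _ => (e : ResidueField S)) (by
      ext x
      rw [Finset.sum_apply]
      exact (hsum x).symm.trans (h x)) ⟨0, hf⟩
    exact heR h1
  set t := ∑ i ∈ Finset.range (f * e), g ^ i • c with ht
  have htu : IsUnit t := by
    by_contra h
    exact hc ((residue_eq_zero_iff t).mpr h)
  obtain ⟨w, hw⟩ := htu.exists_right_inv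
  have hgt : g • t - t ∈ maximalIdeal S := by
    have h : g • t - t = g ^ (f * e) • c - c := by
      rw [ht, Finset.smul_sum, ← Finset.sum_sub_distrib]
      simp_rw [smul_smul, ← pow_succ']
      rw [Finset.sum_range_sub (fun i => g ^ i • c)]
      simp
    rw [h]
    exact hgd c
  have hgt' : ∀ i : ℕ, g ^ i • t - t ∈ maximalIdeal S := by
    intro i
    induction i with
    | zero => simp
    | succ i ih =>
      have h := add_mem (smul_mem_maximalIdeal g ih) hgt
      rwa [smul_sub, sub_add_sub_cancel, smul_smul, ← pow_succ'] at h
  have hgw : ∀ i : ℕ, g ^ i • w - w ∈ maximalIdeal S := by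
    intro i
    have h1 : g ^ i • t * g ^ i • w = 1 := by rw [← smul_mul', hw, smul_one]
    have h : g ^ i • w - w = -(w * g ^ i • w * (g ^ i • t - t)) := by
      linear_combination (-(g ^ i • w)) * hw + w * h1
    rw [h]
    exact neg_mem (Ideal.mul_mem_left _ _ (hgt' i))
  refine ⟨c * w, ?_⟩
  have h : ∑ i ∈ Finset.range (f * e), g ^ i • (c * w) - 1 =
      ∑ i ∈ Finset.range (f * e), g ^ i • c * (g ^ i • w - w) := by
    simp_rw [smul_mul', mul_sub]
    rw [Finset.sum_sub_distrib, ← Finset.sum_mul, ← ht, hw]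
  rw [h]
  exact Ideal.sum_mem _ fun i _ => Ideal.mul_mem_left _ _ (hgw i)

variable {g : G} {d : ℕ} {c : S}

theorem pow_smul_mem_of_stable {I : Ideal S} (hI : ∀ x ∈ I, g • x ∈ I) (i : ℕ) {x : S}
    (hx : x ∈ I) : g ^ i • x ∈ I := by
  induction i with
  | zero => simpa
  | succ i ih => rw [pow_succ', mul_smul]; exact hI _ ih

/-- Invariants modulo `J` are partial traces modulo `J`. -/
theorem sub_sum_pow_smul_mem (hc : ∑ i ∈ Finset.range d, g ^ i • c - 1 ∈ maximalIdeal S)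
    {I J : Ideal S} (hIJ : maximalIdeal S * I ≤ J) (hJ : ∀ x ∈ J, g • x ∈ J) {x : S} (hx : x ∈ I)
    (hgx : g • x - x ∈ J) : x - ∑ i ∈ Finset.range d, g ^ i • (c * x) ∈ J := by
  have hgx' : ∀ i : ℕ, g ^ i • x - x ∈ J := by
    intro i
    induction i with
    | zero => simp
    | succ i ih =>
      have h := add_mem (hJ _ ih) hgx
      rwa [smul_sub, sub_add_sub_cancel, smul_smul, ← pow_succ'] at h
  have h : x - ∑ i ∈ Finset.range d, g ^ i • (c * x) =
      -((∑ i ∈ Finset.range d, g ^ i • c - 1) * x +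
        ∑ i ∈ Finset.range d, g ^ i • c * (g ^ i • x - x)) := by
    simp_rw [smul_mul', mul_sub]
    rw [Finset.sum_sub_distrib, ← Finset.sum_mul]
    ring
  rw [h]
  exact neg_mem (add_mem (hIJ (Ideal.mul_mem_mul hc hx))
    (Ideal.sum_mem _ fun i _ => Ideal.mul_mem_left _ _ (hgx' i)))

/-- Elements of partial trace zero modulo `J` are differences `g • y - y` modulo `J`; the element
`y` comes from the usual average of a cocycle against an element of trace one. -/
theorem exists_sub_smul_sub_mem_of_sum (hc : ∑ i ∈ Finset.range d, g ^ i • c - 1 ∈ maximalIdeal S)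
    {I J : Ideal S} (hIJ : maximalIdeal S * I ≤ J) (hI : ∀ x ∈ I, g • x ∈ I) {x : S} (hx : x ∈ I)
    (hgx : ∑ i ∈ Finset.range d, g ^ i • x ∈ J) : ∃ y ∈ I, x - (g • y - y) ∈ J := by
  let P : ℕ → S := fun i => ∑ k ∈ Finset.range i, g ^ k • x
  have hP : ∀ i, g • P i = P (i + 1) - x := by
    intro i
    simp only [P, Finset.smul_sum, smul_smul, ← pow_succ']
    rw [Finset.sum_range_succ' (fun k => g ^ k • x)]
    simp
  refine ⟨-∑ i ∈ Finset.range d, g ^ i • c * P i, neg_mem (Ideal.sum_mem _ fun i _ =>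
    Ideal.mul_mem_left _ _ (Ideal.sum_mem _ fun k _ => pow_smul_mem_of_stable hI k hx)), ?_⟩
  have h1 : ∑ i ∈ Finset.range d, (g ^ (i + 1) • c * P (i + 1) - g ^ i • c * P i) =
      g ^ d • c * P d := by
    rw [Finset.sum_range_sub (fun i => g ^ i • c * P i)]
    simp [P]
  have h2 : ∑ i ∈ Finset.range d, (g ^ (i + 1) • c - g ^ i • c) = g ^ d • c - c := by
    rw [Finset.sum_range_sub (fun i => g ^ i • c)]
    simp
  have h : x - (g • (-∑ i ∈ Finset.range d, g ^ i • c * P i) -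
      -∑ i ∈ Finset.range d, g ^ i • c * P i) =
      g ^ d • c * P d - (g • (∑ i ∈ Finset.range d, g ^ i • c - 1)) * x := by
    rw [← h1, smul_sub, smul_one, smul_neg, Finset.smul_sum, Finset.smul_sum]
    simp_rw [smul_mul', hP, smul_smul, ← pow_succ', mul_sub]
    rw [Finset.sum_sub_distrib, Finset.sum_sub_distrib, sub_mul, Finset.sum_mul]
    ring
  rw [h]
  refine sub_mem (Ideal.mul_mem_left _ _ hgx) (hIJ (Ideal.mul_mem_mul ?_ hx))
  exact smul_mem_maximalIdeal g hc

end Tame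

end IsLocalRing

/-! ### The filtration of the points of a formal group -/

namespace FormalGroup

namespace LocalPoint

variable {R S : Type*} [CommRing R] [CommRing S] [IsLocalRing S] [Algebra R S]
  [IsAdicComplete (maximalIdeal S) S] {F : FormalGroup R}

/-- Addition in `F(m_S)` is addition in `S` up to higher order. -/
theorem val_add_sub_mem (x : F.LocalPoint S) {y : F.LocalPoint S} {n : ℕ}
    (hy : y.val ∈ maximalIdeal S ^ n) :
    (x + y).val - (x.val + y.val) ∈ maximalIdeal S ^ (n + 1) := by
  have h := adicEval_sub F x.mem y.mem (zero_mem _) (by simpa using hy)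
  have h0 : adicEval F.toPowerSeries ![x.val, 0] = x.val := congrArg val (add_zero' x)
  rw [h0] at h
  convert h using 1
  rw [val_add]
  ring

theorem val_add_mem {x y : F.LocalPoint S} {n : ℕ} (hx : x.val ∈ maximalIdeal S ^ n)
    (hy : y.val ∈ maximalIdeal S ^ n) : (x + y).val ∈ maximalIdeal S ^ n := by
  have h := add_mem (Ideal.pow_le_pow_right (Nat.le_succ n) (val_add_sub_mem x hy)) (add_mem hx hy)
  rwa [sub_add_cancel] at h

variable [F.IsComm]

theorem val_neg_mem {x : F.LocalPoint S} {n : ℕ} (hx : x.val ∈ maximalIdeal S ^ n) :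
    (-x).val ∈ maximalIdeal S ^ n := by
  have h := Ideal.pow_le_pow_right (Nat.le_succ n) (val_add_sub_mem (-x) hx)
  rw [neg_add_cancel, val_zero, zero_sub, neg_mem_iff] at h
  exact (Ideal.add_mem_iff_left _ hx).mp h

variable (F S) in
/-- The filtration of `F(m_S)` by the subgroups `F(m_S ^ n)`; the steps `n = 0` and `n = 1` are both
the whole group. -/
def level (n : ℕ) : AddSubgroup (F.LocalPoint S) where
  carrier := {x | x.val ∈ maximalIdeal S ^ n}
  zero_mem' := zero_mem (maximalIdeal S ^ n)
  add_mem' := val_add_mem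
  neg_mem' := val_neg_mem

theorem mem_level {n : ℕ} {x : F.LocalPoint S} : x ∈ level S F n ↔ x.val ∈ maximalIdeal S ^ n :=
  Iff.rfl

theorem level_antitone : Antitone (level S F) := fun _ _ h _ hx => Ideal.pow_le_pow_right h hx

theorem mem_level_one (x : F.LocalPoint S) : x ∈ level S F 1 := by
  rw [mem_level, pow_one]
  exact x.mem

theorem sub_mem_level_iff {x y : F.LocalPoint S} {n : ℕ} :
    x - y ∈ level S F n ↔ x.val - y.val ∈ maximalIdeal S ^ n := by
  have hxy : ∀ {k : ℕ}, x - y ∈ level S F k →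
      x.val - y.val - (x - y).val ∈ maximalIdeal S ^ (k + 1) := by
    intro k hk
    have h := val_add_sub_mem y (mem_level.mp hk)
    rw [add_sub_cancel] at h
    convert h using 1
    ring
  constructor
  · intro h
    have h1 := add_mem (Ideal.pow_le_pow_right (Nat.le_succ n) (hxy h)) h
    rwa [sub_add_cancel] at h1
  · intro h
    have hk : ∀ k ≤ n, x - y ∈ level S F k := by
      intro k
      induction k with
      | zero => intro _; simp [mem_level]
      | succ k ih =>
        intro hk
        have h1 := sub_mem (Ideal.pow_le_pow_right hk h) (hxy (ih (by omega)))
        rwa [sub_sub_cancel] at h1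
    exact hk n le_rfl

/-- Subtraction in `F(m_S)` is subtraction in `S` up to higher order. -/
theorem val_sub_sub_mem {x y : F.LocalPoint S} {n : ℕ} (h : x - y ∈ level S F n) :
    (x - y).val - (x.val - y.val) ∈ maximalIdeal S ^ (n + 1) := by
  have h1 := neg_mem (val_add_sub_mem y (mem_level.mp h))
  rw [add_sub_cancel] at h1
  convert h1 using 1
  ring

theorem val_sum_sub_mem {ι : Type*} (t : Finset ι) {f : ι → F.LocalPoint S} {n : ℕ}
    (hf : ∀ i ∈ t, f i ∈ level S F n) :
    (∑ i ∈ t, f i).val - ∑ i ∈ t, (f i).val ∈ maximalIdeal S ^ (n + 1) := by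
  classical
  induction t using Finset.induction_on with
  | empty => simp [val_zero]
  | insert a t ha ih =>
    rw [Finset.sum_insert ha, Finset.sum_insert ha]
    have h := val_add_sub_mem (f a) (y := ∑ i ∈ t, f i) (n := n)
      (mem_level.mp (sum_mem fun i hi => hf i (Finset.mem_insert_of_mem hi)))
    have h1 := add_mem h (ih fun i hi => hf i (Finset.mem_insert_of_mem hi))
    convert h1 using 1
    ring

theorem eq_zero_of_mem_level {x : F.LocalPoint S} (h : ∀ n, x ∈ level S F n) : x = 0 := by
  ext
  rw [val_zero]
  refine IsHausdorff.haus' (I := maximalIdeal S) _ fun n => ?_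
  rw [SModEq.zero, smul_eq_mul, Ideal.mul_top]
  exact h n

/-- Series with general term tending to zero converge in `F(m_S)`. -/
theorem exists_sub_sum_mem_level (y : ℕ → F.LocalPoint S) (hy : ∀ n, y n ∈ level S F n) :
    ∃ z, ∀ n, z - ∑ i ∈ Finset.range n, y i ∈ level S F n := by
  obtain ⟨z, hz⟩ := IsPrecomplete.prec' (I := maximalIdeal S)
    (fun n => (∑ i ∈ Finset.range n, y i).val) (by
    intro m n hmn
    induction n, hmn using Nat.le_induction with
    | base => rfl
    | succ n hmn ih =>
      refine ih.trans ?_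
      rw [SModEq.comm, SModEq.sub_mem, smul_eq_mul, Ideal.mul_top, ← sub_mem_level_iff,
        Finset.sum_range_succ, add_sub_cancel_left]
      exact level_antitone hmn (hy n))
  have hz' : ∀ n, z - (∑ i ∈ Finset.range n, y i).val ∈ maximalIdeal S ^ n := by
    intro n
    have := (hz n).symm
    rwa [SModEq.sub_mem, smul_eq_mul, Ideal.mul_top] at this
  have hzm : z ∈ maximalIdeal S := by
    have h := hz' 1
    rw [pow_one] at h
    simpa using add_mem h (mem (∑ i ∈ Finset.range 1, y i))
  exact ⟨⟨z, hzm⟩, fun n => sub_mem_level_iff.mpr (hz' n)⟩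

end LocalPoint

/-! ### Multiplication by the residue characteristic -/

section MulSeries

variable {R : Type*} [CommRing R]

theorem constantCoeff_mulSeries (F : FormalGroup R) (n : ℕ) :
    MvPowerSeries.constantCoeff (F.mulSeries n) = 0 := by
  induction n with
  | zero => exact map_zero _
  | succ n ih =>
    have h : ∀ s : Fin 2, MvPowerSeries.constantCoeff
        ((![F.mulSeries n, PowerSeries.X] : Fin 2 → PowerSeries R) s) = 0 := by
      intro s
      fin_cases s
      · exact ih
      · exact MvPowerSeries.constantCoeff_X _
    exact MvPowerSeries.constantCoeff_subst_eq_zero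
      (MvPowerSeries.hasSubst_of_constantCoeff_zero h) h F.zero_constantCoeff

theorem mulSeries_map {R' : Type*} [CommRing R'] (F : FormalGroup R) (φ : R →+* R') (n : ℕ) :
    (F.map φ).mulSeries n = PowerSeries.map φ (F.mulSeries n) := by
  induction n with
  | zero => exact (map_zero (PowerSeries.map φ)).symm
  | succ n ih =>
    have h : ∀ s : Fin 2, MvPowerSeries.constantCoeff
        ((![F.mulSeries n, PowerSeries.X] : Fin 2 → PowerSeries R) s) = 0 := by
      intro s
      fin_cases s
      · exact F.constantCoeff_mulSeries n
      · exact MvPowerSeries.constantCoeff_X _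
    rw [mulSeries, mulSeries, ih]
    refine Eq.trans ?_ (MvPowerSeries.map_subst
      (MvPowerSeries.hasSubst_of_constantCoeff_zero h) F.toPowerSeries).symm
    rw [FormalGroup.map_toPowerSeries]
    congr 1
    funext s
    fin_cases s
    · rfl
    · exact (PowerSeries.map_X φ).symm

/-- A formal group of height at least two has `[p](X)` of order greater than `p`. -/
theorem coeff_mulSeries_eq_zero_of_height {k : Type*} [CommRing k] (F : FormalGroup k) {p : ℕ}
    (hp : p.Prime) (hF : 2 ≤ F.height p) {n : ℕ} (hn : n ≤ p) :
    PowerSeries.coeff n (F.mulSeries p) = 0 := by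
  obtain ⟨h, ⟨g, hg⟩, hh⟩ : ∃ h ∈ {h : ℕ | ∃ g : PowerSeries k,
      F.mulSeries p = g.subst (PowerSeries.X ^ p ^ h : PowerSeries k)}, 2 ≤ h := by
    by_contra! hlt
    have h1 : F.height p ≤ 1 := iSup₂_le fun h hh => by
      exact_mod_cast Nat.lt_succ_iff.mp (hlt h hh)
    exact absurd (hF.trans h1) (by norm_num)
  rcases Nat.eq_zero_or_pos n with rfl | hpos
  · rw [PowerSeries.coeff_zero_eq_constantCoeff_apply]
    exact F.constantCoeff_mulSeries p
  · rw [hg, PowerSeries.coeff_subst_X_pow (pow_ne_zero _ hp.ne_zero), if_neg]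
    intro hdvd
    have h1 := Nat.le_of_dvd hpos hdvd
    have h2 : p ^ 2 ≤ p ^ h := Nat.pow_le_pow_right hp.pos hh
    nlinarith [hp.two_le]

variable {S : Type*} [CommRing S] [IsLocalRing S] [Algebra R S]
  [IsAdicComplete (maximalIdeal S) S]

theorem LocalPoint.val_nsmul (F : FormalGroup R) [F.IsComm] (n : ℕ) (x : F.LocalPoint S) :
    (n • x).val = adicEval (F.mulSeries n : MvPowerSeries Unit R) fun _ => x.val := by
  induction n with
  | zero => rw [zero_smul]; exact (adicEval_zero (R := R) (σ := Unit) _).symm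
  | succ n ih =>
    have h : ∀ s : Fin 2, MvPowerSeries.constantCoeff
        ((![F.mulSeries n, PowerSeries.X] : Fin 2 → PowerSeries R) s) = 0 := by
      intro s
      fin_cases s
      · exact F.constantCoeff_mulSeries n
      · exact MvPowerSeries.constantCoeff_X _
    rw [succ_nsmul, val_add, mulSeries]
    refine Eq.trans ?_ (adicEval_subst F.toPowerSeries h (a := fun _ : Unit => x.val)
      fun _ => x.mem).symm
    congr 1
    funext s
    fin_cases s
    · exact ih
    · exact (adicEval_X (R := R) () fun _ => x.mem).symm

/-- If the coefficients of `[p](X)` up to degree `p` lie in `m_S ^ p`, then multiplication by `p`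
raises the filtration by `p`. -/
theorem LocalPoint.nsmul_mem_level (F : FormalGroup R) [F.IsComm] {p : ℕ}
    (h : ∀ n ≤ p, algebraMap R S (PowerSeries.coeff n (F.mulSeries p)) ∈ maximalIdeal S ^ p)
    {n : ℕ} (hn : 0 < n) {x : F.LocalPoint S} (hx : x ∈ level S F n) :
    p • x ∈ level S F (n + p) := by
  rw [mem_level, val_nsmul]
  refine hasSum_mem_pow (n + p) (hasSum_adicEval (F.mulSeries p : MvPowerSeries Unit R)
    fun _ => x.mem) fun d => ?_
  have hprod : (d.prod fun _ e => x.val ^ e) = x.val ^ d () := by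
    rw [Finsupp.prod_fintype _ _ (by simp)]
    simp
  have hcoeff : MvPowerSeries.coeff d (F.mulSeries p : MvPowerSeries Unit R) =
      PowerSeries.coeff (d ()) (F.mulSeries p) := by
    rw [PowerSeries.coeff_def rfl]
  rw [hprod, hcoeff]
  have hxd : x.val ^ d () ∈ maximalIdeal S ^ (n * d ()) := by
    rw [pow_mul]; exact Ideal.pow_mem_pow hx _
  rcases Nat.eq_zero_or_pos (d ()) with h0 | hpos
  · have h1 : PowerSeries.coeff 0 (F.mulSeries p) = 0 := by
      rw [PowerSeries.coeff_zero_eq_constantCoeff_apply]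
      exact F.constantCoeff_mulSeries p
    rw [h0, h1]
    simp
  · rcases Nat.lt_or_ge p (d ()) with hlt | hle
    · refine Ideal.mul_mem_left _ _ (Ideal.pow_le_pow_right ?_ hxd)
      nlinarith
    · rw [add_comm, pow_add]
      exact Ideal.mul_mem_mul (h _ hle)
        (Ideal.pow_le_pow_right (Nat.le_mul_of_pos_right n hpos) hxd)

end MulSeries

end FormalGroup

namespace FormalGroup

namespace LocalPoint

/-! ### Cohomological triviality of the points over a weakly ramified ring -/

section Exact

variable {R S G : Type*} [CommRing R] [CommRing S] [IsLocalRing S] [Algebra R S]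
  [IsAdicComplete (maximalIdeal S) S] {F : FormalGroup R} [F.IsComm] [Group G]
  [MulSemiringAction G S] [SMulCommClass G R S]

theorem val_sum_pow_sub_mem (g : G) (d : ℕ) {n : ℕ} {x : F.LocalPoint S}
    (hx : x ∈ level S F n) :
    ((∑ i ∈ Finset.range d, DistribMulAction.toAddMonoidEnd G (F.LocalPoint S) g ^ i) x).val -
      ∑ i ∈ Finset.range d, g ^ i • x.val ∈ maximalIdeal S ^ (n + 1) := by
  have hpow : ∀ i : ℕ, (DistribMulAction.toAddMonoidEnd G (F.LocalPoint S) g ^ i) x = g ^ i • x := by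
    intro i
    rw [← map_pow]
    rfl
  rw [AddMonoid.End.sum_apply]
  simp_rw [hpow]
  exact val_sum_sub_mem _ fun i _ => smul_mem_maximalIdeal_pow (g ^ i) hx

/-- The graded pieces of `F(m_S)` have trivial cohomology for a cyclic group with an element of
partial trace one in the residue field. -/
theorem exactOn_level (g : G) {d : ℕ} {c : S}
    (hc : ∑ i ∈ Finset.range d, g ^ i • c - 1 ∈ maximalIdeal S) {n : ℕ} (hn : 0 < n) :
    AddSubgroup.ExactOn (DistribMulAction.toAddMonoidEnd G (F.LocalPoint S) g - 1)
        (∑ i ∈ Finset.range d, DistribMulAction.toAddMonoidEnd G (F.LocalPoint S) g ^ i)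
        (level S F n) (level S F (n + 1)) ∧
      AddSubgroup.ExactOn
        (∑ i ∈ Finset.range d, DistribMulAction.toAddMonoidEnd G (F.LocalPoint S) g ^ i)
        (DistribMulAction.toAddMonoidEnd G (F.LocalPoint S) g - 1)
        (level S F n) (level S F (n + 1)) := by
  have hIJ : maximalIdeal S * maximalIdeal S ^ n ≤ maximalIdeal S ^ (n + 1) :=
    (pow_succ' (maximalIdeal S) n).ge
  have hle : maximalIdeal S ^ n ≤ maximalIdeal S := by
    simpa using Ideal.pow_le_pow_right (I := maximalIdeal S) hn
  constructor
  · intro x hx hgx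
    have hgx' : g • x - x ∈ level S F (n + 1) := hgx
    have hcx : c * x.val ∈ maximalIdeal S ^ n := Ideal.mul_mem_left _ _ hx
    refine ⟨⟨c * x.val, hle hcx⟩, hcx, ?_⟩
    rw [sub_mem_level_iff]
    have h1 := sub_sum_pow_smul_mem hc hIJ (fun _ => smul_mem_maximalIdeal_pow g) hx (sub_mem_level_iff.mp hgx')
    have h2 := val_sum_pow_sub_mem (F := F) g d (x := ⟨c * x.val, hle hcx⟩) hcx
    have h3 := sub_mem h1 h2
    convert h3 using 1
    ring
  · intro x hx hNx
    have h1 := sub_mem (mem_level.mp hNx) (val_sum_pow_sub_mem (F := F) g d hx)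
    rw [sub_sub_cancel] at h1
    obtain ⟨y, hy, hxy⟩ := exists_sub_smul_sub_mem_of_sum hc hIJ (fun _ => smul_mem_maximalIdeal_pow g) hx h1
    let y' : F.LocalPoint S := ⟨y, hle hy⟩
    refine ⟨y', hy, ?_⟩
    have hy' : g • y' - y' ∈ level S F n := sub_mem (smul_mem_maximalIdeal_pow g hy) hy
    have h2 := sub_mem hxy (val_sub_sub_mem hy')
    change x - (g • y' - y') ∈ level S F (n + 1)
    rw [sub_mem_level_iff]
    convert h2 using 1
    change _ = x.val - (g • y - y) - ((g • y' - y').val - (g • y - y))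
    ring

end Exact

section WeaklyRamified

variable {R S G : Type*} [CommRing R] [CommRing S] [IsDomain S] [IsDiscreteValuationRing S]
  [Algebra R S] [IsAdicComplete (maximalIdeal S) S] {F : FormalGroup R} [F.IsComm] [Group G]
  [MulSemiringAction G S] [SMulCommClass G R S]

/-- The wildly ramified case: `g ^ d` generates the first ramification group, of order `p`, and the
quotients of the filtration by jumps of length `p` are killed by `p`. -/
theorem exactOn_of_smul_sub_mem {p : ℕ} (hp : p.Prime) (hpm : (p : S) ∈ maximalIdeal S)
    (hperf : ∀ x : S, ∃ y, x - y ^ p ∈ maximalIdeal S)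
    (hF : ∀ n ≤ p, algebraMap R S (PowerSeries.coeff n (F.mulSeries p)) ∈ maximalIdeal S)
    {g : G} {d : ℕ} {c : S} (hc : ∑ i ∈ Finset.range d, g ^ i • c - 1 ∈ maximalIdeal S)
    (hs : ∀ x : S, g ^ d • x - x ∈ maximalIdeal S ^ 2)
    (hs3 : ¬ ∀ x : S, g ^ d • x - x ∈ maximalIdeal S ^ 3) {n : ℕ} (hn : 0 < n)
    (hnp : n ≡ 1 [MOD p]) :
    AddSubgroup.ExactOn (DistribMulAction.toAddMonoidEnd G (F.LocalPoint S) g - 1)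
        (∑ i ∈ Finset.range (d * p), DistribMulAction.toAddMonoidEnd G (F.LocalPoint S) g ^ i)
        (level S F n) (level S F (n + p)) ∧
      AddSubgroup.ExactOn
        (∑ i ∈ Finset.range (d * p), DistribMulAction.toAddMonoidEnd G (F.LocalPoint S) g ^ i)
        (DistribMulAction.toAddMonoidEnd G (F.LocalPoint S) g - 1)
        (level S F n) (level S F (n + p)) := by
  have : Fact p.Prime := ⟨hp⟩
  have hgd : ∀ x, (DistribMulAction.toAddMonoidEnd G (F.LocalPoint S) g ^ d) x = g ^ d • x := by
    intro x
    rw [← map_pow]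
    rfl
  -- a coefficient of `F` is fixed by the group, so it lies in the `p`-th power of the maximal ideal
  have hcoeff : ∀ n ≤ p, algebraMap R S (PowerSeries.coeff n (F.mulSeries p)) ∈
      maximalIdeal S ^ p := fun n hn =>
    mem_pow_of_smul_eq hp hpm hperf hs hs3 (hF n hn) (smul_algebraMap _ _)
  have hjumps := AddSubgroup.exactOn_of_jumps (level_antitone (S := S) (F := F))
    (s := DistribMulAction.toAddMonoidEnd G (F.LocalPoint S) g ^ d) (p := p) hn hnp
    (fun j x hx => by
      rw [hgd, sub_mem_level_iff]
      exact smul_sub_mem_pow_succ hs hx)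
    (fun j hj x hx hsx => by
      rw [hgd, sub_mem_level_iff] at hsx
      exact mem_pow_succ_of_smul_sub_mem hp hpm hperf hs hs3 hj hx hsx)
    (fun j hj0 hj y hy => by
      obtain ⟨x, hx, hxy⟩ := exists_sub_smul_sub_mem hp hpm hperf hs hs3 hj hy
      let x' : F.LocalPoint S := ⟨x, Ideal.pow_le_self hj0.ne' hx⟩
      refine ⟨x', hx, ?_⟩
      have h1 : g ^ d • x' - x' ∈ level S F (j + 1) :=
        sub_mem_level_iff.mpr (smul_sub_mem_pow_succ hs hx)
      have h2 := sub_mem hxy (val_sub_sub_mem h1)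
      rw [hgd, sub_mem_level_iff]
      convert h2 using 1
      change _ = y.val - (g ^ d • x - x) - ((g ^ d • x' - x').val - (g ^ d • x - x))
      ring)
    (fun x hx => nsmul_mem_level F hcoeff hn hx)
  obtain ⟨h1, h2, h3, h4⟩ := hjumps
  have hgr := exactOn_level (F := F) g hc (n := n + p - 1) (by have := hp.pos; omega)
  rw [show n + p - 1 + 1 = n + p by have := hp.pos; omega] at hgr
  exact AddSubgroup.exactOn_of_subgroup (fun _ => smul_mem_maximalIdeal_pow g) (fun _ => smul_mem_maximalIdeal_pow g)
    h1 h2 h3 h4 hgr.1 hgr.2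

/-- Tate cohomology of `F(m_S)` vanishes for a cyclic group whose second ramification group is
trivial, if the coefficients of `[p](X)` of degree at most `p` are not units. -/
theorem exact_sub_one_norm {p : ℕ} (hp : p.Prime) (hpm : (p : S) ∈ maximalIdeal S)
    (hperf : ∀ x : S, ∃ y, x - y ^ p ∈ maximalIdeal S)
    (hF : ∀ n ≤ p, algebraMap R S (PowerSeries.coeff n (F.mulSeries p)) ∈ maximalIdeal S)
    (hweak : ∀ s : G, (∀ x : S, s • x - x ∈ maximalIdeal S ^ 3) → s = 1) {g : G}
    (hg : IsOfFinOrder g) (x : F.LocalPoint S) :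
    (g • x = x → ∃ y : F.LocalPoint S, ∑ i ∈ Finset.range (orderOf g), g ^ i • y = x) ∧
      (∑ i ∈ Finset.range (orderOf g), g ^ i • x = 0 → ∃ y : F.LocalPoint S, g • y - y = x) := by
  set γ := DistribMulAction.toAddMonoidEnd G (F.LocalPoint S) g with hγ
  obtain ⟨d, hd, hdk⟩ := ((maximalIdeal S ^ 2).toAddSubgroup.inertia G).exists_pow_mem_iff_dvd hg
  have hs : ∀ x : S, g ^ d • x - x ∈ maximalIdeal S ^ 2 := (hdk d).mpr dvd_rfl
  obtain ⟨c, hc⟩ := exists_sum_pow_smul_sub_one_mem hp hpm hg hd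
    (fun x => Ideal.pow_le_self two_ne_zero (hs x)) fun k hk hkp => (hdk k).mp
      (smul_sub_mem_sq_of_pow hp hpm hperf hk (by rw [← pow_mul]; exact (hdk _).mpr hkp))
  obtain ⟨q, hq⟩ : d ∣ orderOf g := (hdk _).mp (by rw [pow_orderOf_eq_one]; exact one_mem _)
  -- `q` is the order of the first ramification group
  have hqp : q ∣ p := by
    have h1 : orderOf g ∣ d * p := orderOf_dvd_of_pow_eq_one (by
      rw [pow_mul]; exact hweak _ (pow_smul_sub_mem_cube hp hpm hperf hs))
    rw [hq] at h1
    exact Nat.dvd_of_mul_dvd_mul_left hd h1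
  have hq0 : 0 < q := Nat.pos_of_dvd_of_pos hqp hp.pos
  have hex : ∀ k : ℕ,
      AddSubgroup.ExactOn (γ - 1) (∑ i ∈ Finset.range (orderOf g), γ ^ i)
        (level S F (1 + k * q)) (level S F (1 + (k + 1) * q)) ∧
      AddSubgroup.ExactOn (∑ i ∈ Finset.range (orderOf g), γ ^ i) (γ - 1)
        (level S F (1 + k * q)) (level S F (1 + (k + 1) * q)) := by
    intro k
    rw [show 1 + (k + 1) * q = 1 + k * q + q by ring, hq]
    rcases (Nat.dvd_prime hp).mp hqp with rfl | rfl
    · rw [mul_one d]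
      exact exactOn_level g hc (by omega)
    · refine exactOn_of_smul_sub_mem hp hpm hperf hF hc hs (fun h => ?_) (by omega) ?_
      · have h1 := Nat.le_of_dvd hd (orderOf_dvd_of_pow_eq_one (hweak _ h))
        rw [hq] at h1
        nlinarith [hp.two_le]
      · simp [Nat.ModEq]
  have hγlevel : ∀ n, ∀ x ∈ level S F n, γ x ∈ level S F n := fun _ _ =>
    smul_mem_maximalIdeal_pow g
  have hpow : ∀ (i : ℕ) (x : F.LocalPoint S), (γ ^ i) x = g ^ i • x := by
    intro i x
    rw [hγ, ← map_pow]
    rfl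
  have hnorm : ∀ x : F.LocalPoint S, (∑ i ∈ Finset.range (orderOf g), γ ^ i) x =
      ∑ i ∈ Finset.range (orderOf g), g ^ i • x := fun x => by
    rw [AddMonoid.End.sum_apply]
    simp_rw [hpow]
  have hγ1 : γ ^ orderOf g = 1 := by rw [hγ, ← map_pow, pow_orderOf_eq_one, map_one]
  have hle : ∀ n, level S F (1 + n * q) ≤ level S F n := fun n => level_antitone (by nlinarith)
  have htop : level S F (1 + 0 * q) = ⊤ := by
    rw [eq_top_iff]
    intro x _
    simpa using mem_level_one x
  constructor
  · intro hx
    obtain ⟨y, hy⟩ := AddSubgroup.exact_of_exactOn (φ := γ - 1)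
      (ψ := ∑ i ∈ Finset.range (orderOf g), γ ^ i) hle htop
      (fun n x hx => by
        rw [hnorm]
        exact sum_mem fun i _ => smul_mem_maximalIdeal_pow (g ^ i) hx)
      exists_sub_sum_mem_level (fun _ => eq_zero_of_mem_level)
      (by rw [mul_geom_sum, hγ1, sub_self]) (fun k => (hex k).1) (x := x)
      (sub_eq_zero.mpr hx)
    exact ⟨y, by rw [← hnorm, hy]⟩
  · intro hx
    obtain ⟨y, hy⟩ := AddSubgroup.exact_of_exactOn (ψ := γ - 1)
      (φ := ∑ i ∈ Finset.range (orderOf g), γ ^ i) hle htop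
      (fun n x hx => sub_mem (hγlevel n x hx) hx)
      exists_sub_sum_mem_level (fun _ => eq_zero_of_mem_level)
      (by rw [geom_sum_mul, hγ1, sub_self]) (fun k => (hex k).2) (x := x)
      (by rw [hnorm, hx])
    exact ⟨y, hy⟩

end WeaklyRamified

end LocalPoint

end FormalGroup

/-! ### Local fields -/

namespace IsLocalRing

theorem prime_ringChar_residueField (R : Type*) [CommRing R] [IsLocalRing R]
    [Finite (ResidueField R)] : (ringChar (ResidueField R)).Prime := by
  have := Fintype.ofFinite (ResidueField R)
  exact CharP.char_is_prime (ResidueField R) _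

theorem exists_sub_pow_mem {S : Type*} [CommRing S] [IsLocalRing S] [Finite (ResidueField S)]
    {p : ℕ} (hp : p.Prime) (hpm : (p : S) ∈ maximalIdeal S) (x : S) :
    ∃ y, x - y ^ p ∈ maximalIdeal S := by
  have : Fact p.Prime := ⟨hp⟩
  have h0 : (p : ResidueField S) = 0 := by
    rw [← map_natCast (residue S), residue_eq_zero_iff]
    exact hpm
  have : CharP (ResidueField S) p := (CharP.charP_iff_prime_eq_zero hp).mpr h0
  obtain ⟨y, hy⟩ := (bijective_frobenius (ResidueField S) p).2 (residue S x)
  obtain ⟨y, rfl⟩ := residue_surjective y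
  refine ⟨y, ?_⟩
  rw [← residue_eq_zero_iff, map_sub, map_pow, ← hy, frobenius_def, sub_self]

end IsLocalRing

theorem sum_range_orderOf_pow {G M : Type*} [Group G] [Fintype G] [AddCommMonoid M] {g : G}
    (hg : ∀ x, x ∈ Subgroup.zpowers g) (f : G → M) :
    ∑ i ∈ Finset.range (orderOf g), f (g ^ i) = ∑ s : G, f s := by
  classical
  rw [← IsCyclic.image_range_orderOf hg, Finset.sum_image]
  intro i hi j hj h
  exact pow_injOn_Iio_orderOf (by simpa using hi) (by simpa using hj) h

open CategoryTheory Rep.FiniteCyclicGroup in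
theorem groupCohomology.subsingleton_of_commGroup {k G : Type u} [CommRing k] [CommGroup G]
    [Fintype G] (A : Rep k G) {g : G} (hg : ∀ x, x ∈ Subgroup.zpowers g)
    (h₁ : ∀ x : A, A.ρ g x = x → ∃ y : A, A.ρ.norm y = x)
    (h₂ : ∀ x : A, A.ρ.norm x = 0 → ∃ y : A, A.ρ g y - y = x)
    {i : ℕ} (hi : 0 < i) : Subsingleton (groupCohomology A i) := by
  have : NeZero i := ⟨hi.ne'⟩
  refine ModuleCat.subsingleton_of_isZero ?_
  rcases Nat.even_or_odd i with he | ho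
  · refine Limits.IsZero.of_iso ?_ (groupCohomologyIsoEven A g hg i he)
    rw [← ShortComplex.exact_iff_isZero_homology, ShortComplex.moduleCat_exact_iff]
    intro x hx
    exact h₁ x (sub_eq_zero.mp hx)
  · refine Limits.IsZero.of_iso ?_ (groupCohomologyIsoOdd A g hg i ho)
    rw [← ShortComplex.exact_iff_isZero_homology, ShortComplex.moduleCat_exact_iff]
    intro x hx
    exact h₂ x hx

/-- The cohomology of a finite cyclic group vanishes in positive degrees as soon as its Tate
cohomology groups in degrees `0` and `-1` vanish. -/
theorem groupCohomology.subsingleton_of_cyclic {k G : Type u} [CommRing k] [Group G] [Finite G]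
    (A : Type u) [AddCommGroup A] [Module k A] [DistribMulAction G A] [SMulCommClass G k A]
    {g : G} (hg : ∀ x, x ∈ Subgroup.zpowers g)
    (h₁ : ∀ x : A, g • x = x → ∃ y : A, ∑ i ∈ Finset.range (orderOf g), g ^ i • y = x)
    (h₂ : ∀ x : A, ∑ i ∈ Finset.range (orderOf g), g ^ i • x = 0 → ∃ y : A, g • y - y = x)
    {i : ℕ} (hi : 0 < i) : Subsingleton (groupCohomology (Rep.ofDistribMulAction k G A) i) := by
  have hcyc : IsCyclic G := ⟨g, hg⟩
  have hfin := Fintype.ofFinite G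
  have hN : ∀ x : A, (Representation.ofDistribMulAction k G A).norm x =
      ∑ i ∈ Finset.range (orderOf g), g ^ i • x := fun x => by
    rw [sum_range_orderOf_pow hg (fun s => s • x), Representation.norm_ofDistribMulAction_eq]
  refine @groupCohomology.subsingleton_of_commGroup k G _ IsCyclic.commGroup hfin
    (Rep.ofDistribMulAction k G A) g hg (fun x hx => ?_) (fun x hx => h₂ x ((hN x).symm.trans hx))
    i hi
  obtain ⟨y, hy⟩ := h₁ x hx
  exact ⟨y, (hN y).trans hy⟩

namespace IsNonarchimedeanLocalField

variable {K : Type v} {L : Type u}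
    [Field K] [ValuativeRel K] [TopologicalSpace K] [IsNonarchimedeanLocalField K]
    [Field L] [ValuativeRel L] [TopologicalSpace L] [IsNonarchimedeanLocalField L]
    [Algebra K L] [ValuativeExtension K L]

theorem algebraMap_mem_maximalIdeal {x : 𝒪[K]} (hx : x ∈ 𝓂[K]) : algebraMap 𝒪[K] 𝒪[L] x ∈ 𝓂[L] := by
  rw [mem_maximalIdeal_iff] at hx ⊢
  exact (Valuation.HasExtension.val_map_lt_one_iff (valuation K) (valuation L) (x : K)).mpr hx

theorem eq_one_of_smul_sub_mem [FiniteDimensional K L] (hram : IsAtMostWeaklyRamified K L)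
    (s : Gal(L/K)) (hs : ∀ x : 𝒪[L], s • x - x ∈ 𝓂[L] ^ 3) : s = 1 := by
  have h : s ∈ ramificationGroup K L 2 := hs
  rwa [hram, Subgroup.mem_bot] at h

end IsNonarchimedeanLocalField

theorem FormalGroup.coeff_mulSeries_mem_maximalIdeal {R : Type*} [CommRing R] [IsLocalRing R]
    (F : FormalGroup R) {p : ℕ} (hp : p.Prime) (hF : 2 ≤ (F.map (residue R)).height p) {n : ℕ}
    (hn : n ≤ p) : PowerSeries.coeff n (F.mulSeries p) ∈ maximalIdeal R := by
  have h := coeff_mulSeries_eq_zero_of_height _ hp hF hn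
  rwa [mulSeries_map, PowerSeries.coeff_map, residue_eq_zero_iff] at h

theorem mainTheorem12 {K : Type v} {L : Type u}
    [Field K] [ValuativeRel K] [TopologicalSpace K] [IsNonarchimedeanLocalField K]
    [Field L] [ValuativeRel L] [TopologicalSpace L] [IsNonarchimedeanLocalField L]
    [Algebra K L] [ValuativeExtension K L] [FiniteDimensional K L] [IsGalois K L]
    [IsCyclic Gal(L/K)]
    (hram : IsNonarchimedeanLocalField.IsAtMostWeaklyRamified K L)
    (F : FormalGroup 𝒪[K]) [F.IsComm] (hF : 2 ≤ F.localHeight) :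
    Function.Surjective (F.norm L) ∧
      ∀ i : ℕ, 0 < i → Subsingleton (F.galoisCohomology L i) := by
  obtain ⟨g, hg⟩ := IsCyclic.exists_generator (α := Gal(L/K))
  have hp := prime_ringChar_residueField 𝒪[K]
  have hpK : (ringChar 𝓀[K] : 𝒪[K]) ∈ 𝓂[K] := by
    rw [← residue_eq_zero_iff, map_natCast]
    exact ringChar.Nat.cast_ringChar
  have hpL : (ringChar 𝓀[K] : 𝒪[L]) ∈ 𝓂[L] := by
    rw [← map_natCast (algebraMap 𝒪[K] 𝒪[L])]
    exact IsNonarchimedeanLocalField.algebraMap_mem_maximalIdeal hpK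
  have hexact := fun x : F.LocalPoint 𝒪[L] => FormalGroup.LocalPoint.exact_sub_one_norm hp hpL
    (exists_sub_pow_mem hp hpL)
    (fun n hn => IsNonarchimedeanLocalField.algebraMap_mem_maximalIdeal (F.coeff_mulSeries_mem_maximalIdeal hp hF hn))
    (IsNonarchimedeanLocalField.eq_one_of_smul_sub_mem hram) (isOfFinOrder_of_finite g) x
  refine ⟨fun y => ?_, fun i hi => groupCohomology.subsingleton_of_cyclic _ hg
    (fun x => (hexact x).1) (fun x => (hexact x).2) hi⟩
  obtain ⟨x, hx⟩ := (hexact (F.inclusion L y)).1 (FormalGroup.LocalPoint.ext (smul_algebraMap g y.val))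
  refine ⟨x, F.inclusion_injective L ?_⟩
  rw [FormalGroup.inclusion_norm, ← hx, sum_range_orderOf_pow hg (fun s => s • x)]
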